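/- A one-counter energy game of dimension $n$ consists of disjoint finite sets $Q_0,Q_1$ of control-states (of Players $0$ and $1$) and finite transition relations $\delta\subseteq Q\times\{-1,0,1\}\times Q\times\{-1,0,1\}^n$ and $\delta_0\subseteq Q\times\{0,1\}\times Q\times\{-1,0,1\}^n$, where $Q=Q_0\cup Q_1$. It induces a graph on configurations $(p,m,E)\in Q\times\mathbb N\times\mathbb Z^n$: $(p,m,E)\to(p',m',E')$ iff either $(p,d,p',C)\in\delta$, $m'=m+d\ge 0$ and $E'=E+C$, or $(p,d,p',C)\in\delta_0$, $m=0$, $m'=d$ and $E'=E+C$. Every configuration is assumed to have an outgoing edge. The owner of the current control-state chooses the next edge; Player $0$ wins as soon as some component of the energy $E$ is negative, and Player $1$ wins every infinite play. The fixed initial credit problem asks, given a game and a starting configuration (including the initial energy), whether Player $1$ has a winning strategy. A one-counter automaton (OCA) consists of a finite set $Q$ of control-states, a finite set $\mathit{Act}$ of action labels, and transition relations $\delta\subseteq Q\times\mathit{Act}\times\{-1,0,1\}\times Q$, $\delta_0\subseteq Q\times\mathit{Act}\times\{0,1\}\times Q$. On $Q\times\mathbb N$ it has the steps $(p,m)\xrightarrow{a}(p',m')$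 with $(p,a,d,p')\in\delta$ and $m'=m+d\ge 0$, or with $(p,a,d,p')\in\delta_0$, $m=0$ and $m'=d$. A $k$-dimensional vector addition system with states (VASS) consists of finite sets $Q'$, $\mathit{Act}$ and $\delta'\subseteq Q'\times\mathit{Act}\times Q'\times\{-1,0,1\}^k$; on $Q'\times\mathbb N^k$ it has the steps $(p,C)\xrightarrow{a}(p',C+D)$ with $(p,a,p',D)\in\delta'$ and $C+D\in\mathbb N^k$. A configuration $s$ is simulated by $s'$ if $(s,s')$ lies in a relation $R$ such that for all $(t,t')\in R$ and every step $t\xrightarrow{a}u$ there is a step $t'\xrightarrow{a}u'$ with $(u,u')\in R$. **Theorem.** (1) For every $n\ge 2$, the fixed initial credit problem for one-counter energy games of dimension $n$ is undecidable. (2) The following problem is undecidable: given an OCA and a $2$-dimensional VASS over the same action labels, and a configuration of each, is the configuration of the OCA simulated by that of the VASS? -/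

import Mathlib

namespace InfiniteStateGames

/-- The three-element set `{-1, 0, 1}` is encoded by `Fin 3`. -/
instance : Primcodable SignType :=
  Primcodable.ofEquiv (Fin 3) SignType.fin3Equiv.toEquiv

/-- Undecidability of the problem "given `x` with `valid x`, does `P x` hold?": no computable
function gives the right answer on all valid inputs (whatever it may answer on other inputs). -/
def UndecidableOn {α : Type*} [Primcodable α] (valid P : α → Prop) : Prop :=
  ¬ ∃ f : α → Bool, Computable f ∧ ∀ x, valid x → (f x = true ↔ P x)

/-! ### One-counter energy games -/

/-- (The finite presentation of) a one-counter energy game of dimension `n`.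
Control-states are named by natural numbers, and finite sets are given by lists of their elements.
The two sets of transitions hold tuples `(p, d, p', C)`, with `d` the change of the counter and
`C` the change of the energy. -/
structure OCEnergyGame (n : ℕ) where
  /-- control-states of player 0 -/
  Q₀ : List ℕ
  /-- control-states of player 1 -/
  Q₁ : List ℕ
  /-- transitions that do not test the counter -/
  δ : List (ℕ × SignType × ℕ × (Fin n → SignType))
  /-- zero-testing transitions -/
  δ₀ : List (ℕ × Fin 2 × ℕ × (Fin n → SignType))

namespace OCEnergyGame

variable {n : ℕ}

/-- A game as the tuple of its components. -/
def equivProd (n : ℕ) : OCEnergyGame n ≃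
    List ℕ × List ℕ × List (ℕ × SignType × ℕ × (Fin n → SignType)) ×
      List (ℕ × Fin 2 × ℕ × (Fin n → SignType)) where
  toFun G := (G.Q₀, G.Q₁, G.δ, G.δ₀)
  invFun x := ⟨x.1, x.2.1, x.2.2.1, x.2.2.2⟩
  left_inv _ := rfl
  right_inv _ := rfl

instance : Primcodable (OCEnergyGame n) := Primcodable.ofEquiv _ (equivProd n)

/-- Configurations `(p, m, E)`: control-state, counter value, energy. -/
abbrev Config (n : ℕ) : Type := ℕ × ℕ × (Fin n → ℤ)

/-- `p` is a control-state of `G`. -/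
def IsState (G : OCEnergyGame n) (p : ℕ) : Prop := p ∈ G.Q₀ ∨ p ∈ G.Q₁

/-- The edges of the induced infinite game graph. -/
inductive Step (G : OCEnergyGame n) : Config n → Config n → Prop
  | count {p p' m m' : ℕ} {E : Fin n → ℤ} {d : SignType} {C : Fin n → SignType}
      (mem : (p, d, p', C) ∈ G.δ) (hm : (m' : ℤ) = (m : ℤ) + (d : ℤ)) :
      Step G (p, m, E) (p', m', fun i => E i + (C i : ℤ))
  | zero {p p' : ℕ} {E : Fin n → ℤ} {d : Fin 2} {C : Fin n → SignType}
      (mem : (p, d, p', C) ∈ G.δ₀) :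
      Step G (p, 0, E) (p', (d : ℕ), fun i => E i + (C i : ℤ))

/-- `G` is a one-counter energy game: `Q₀`, `Q₁` are disjoint, the transitions
are between states of `G`, and every configuration has at least one outgoing transition. -/
structure WellFormed (G : OCEnergyGame n) : Prop where
  disjoint : ∀ p, ¬ (p ∈ G.Q₀ ∧ p ∈ G.Q₁)
  states : ∀ p d p' C, (p, d, p', C) ∈ G.δ → G.IsState p ∧ G.IsState p'
  states₀ : ∀ p d p' C, (p, d, p', C) ∈ G.δ₀ → G.IsState p ∧ G.IsState p'
  nonblocking : ∀ (p m : ℕ) (E : Fin n → ℤ), G.IsState p → ∃ c, G.Step (p, m, E) c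

/-- Some component of the energy is negative: the game stops and player 0 wins. -/
def Negative (c : Config n) : Prop := ∃ i, c.2.2 i < 0

/-- Strategies of player 1: whenever the configuration `c`, reached after the sequence `h` of
earlier configurations, belongs to player 1, the strategy chooses an outgoing transition. -/
structure Strategy (G : OCEnergyGame n) where
  /-- the configuration to which player 1 moves -/
  next : List (Config n) → Config n → Config n
  legal : ∀ (h : List (Config n)) (c : Config n), c.1 ∈ G.Q₁ →
    (∃ c', G.Step c c') → G.Step c (next h c)

/-- `π 0, …, π k` is a (partial) play from `c` in which player 1 follows `σ`. -/
def Strategy.IsPlay {G : OCEnergyGame n} (σ : G.Strategy) (c : Config n)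
    (π : ℕ → Config n) (k : ℕ) : Prop :=
  π 0 = c ∧ ∀ i < k, G.Step (π i) (π (i + 1)) ∧
    ((π i).1 ∈ G.Q₁ → π (i + 1) = σ.next ((List.range i).map π) (π i))

/-- Player 1 has a winning strategy from `c`. As every configuration of a (well-formed) game has a
successor, a play is won by player 1 iff it never reaches a configuration of negative energy. -/
def Player1Wins (G : OCEnergyGame n) (c : Config n) : Prop :=
  ∃ σ : G.Strategy, ∀ π k, σ.IsPlay c π k → ¬ Negative (π k)

end OCEnergyGame

/-- Inputs of the fixed initial credit problem: a one-counter energy game with a starting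
configuration, which includes the initial energy. -/
def ValidCreditInput {n : ℕ} (x : OCEnergyGame n × OCEnergyGame.Config n) : Prop :=
  x.1.WellFormed ∧ x.1.IsState x.2.1

/-- The question of the fixed initial credit problem. -/
def FixedInitialCredit {n : ℕ} (x : OCEnergyGame n × OCEnergyGame.Config n) : Prop :=
  x.1.Player1Wins x.2

/-! ### One-counter automata, vector addition systems with states, simulation -/

/-- (The finite presentation of) a one-counter automaton; states and action labels are named by
natural numbers. The sets of transitions hold tuples `(p, a, d, p')`. -/
structure OCA where
  /-- control-states -/
  Q : List ℕ
  /-- action labels -/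
  Act : List ℕ
  /-- transitions that do not test the counter -/
  δ : List (ℕ × ℕ × SignType × ℕ)
  /-- zero-testing transitions -/
  δ₀ : List (ℕ × ℕ × Fin 2 × ℕ)

namespace OCA

/-- An automaton as the tuple of its components. -/
def equivProd : OCA ≃
    List ℕ × List ℕ × List (ℕ × ℕ × SignType × ℕ) × List (ℕ × ℕ × Fin 2 × ℕ) where
  toFun A := (A.Q, A.Act, A.δ, A.δ₀)
  invFun x := ⟨x.1, x.2.1, x.2.2.1, x.2.2.2⟩
  left_inv _ := rfl
  right_inv _ := rfl

instance : Primcodable OCA := Primcodable.ofEquiv _ equivProd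

/-- Transitions join states of `A` and carry labels of `A`. -/
structure WellFormed (A : OCA) : Prop where
  trans : ∀ p a d p', (p, a, d, p') ∈ A.δ → p ∈ A.Q ∧ a ∈ A.Act ∧ p' ∈ A.Q
  trans₀ : ∀ p a d p', (p, a, d, p') ∈ A.δ₀ → p ∈ A.Q ∧ a ∈ A.Act ∧ p' ∈ A.Q

/-- The induced labeled transition relation on configurations `(p, m)`. -/
inductive Step (A : OCA) : ℕ × ℕ → ℕ → ℕ × ℕ → Prop
  | count {p p' a m m' : ℕ} {d : SignType}
      (mem : (p, a, d, p') ∈ A.δ) (hm : (m' : ℤ) = (m : ℤ) + (d : ℤ)) :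
      Step A (p, m) a (p', m')
  | zero {p p' a : ℕ} {d : Fin 2} (mem : (p, a, d, p') ∈ A.δ₀) :
      Step A (p, 0) a (p', (d : ℕ))

end OCA

/-- (The finite presentation of) a vector addition system with states of dimension `n`.
The set of transitions holds tuples `(p, a, p', D)`. -/
structure VASS (n : ℕ) where
  /-- control-states -/
  Q : List ℕ
  /-- action labels -/
  Act : List ℕ
  /-- transitions -/
  δ : List (ℕ × ℕ × ℕ × (Fin n → SignType))

namespace VASS

variable {n : ℕ}

/-- A system as the tuple of its components. -/
def equivProd (n : ℕ) : VASS n ≃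
    List ℕ × List ℕ × List (ℕ × ℕ × ℕ × (Fin n → SignType)) where
  toFun B := (B.Q, B.Act, B.δ)
  invFun x := ⟨x.1, x.2.1, x.2.2⟩
  left_inv _ := rfl
  right_inv _ := rfl

instance : Primcodable (VASS n) := Primcodable.ofEquiv _ (equivProd n)

/-- Transitions join states of `B` and carry labels of `B`. -/
structure WellFormed (B : VASS n) : Prop where
  trans : ∀ p a p' D, (p, a, p', D) ∈ B.δ → p ∈ B.Q ∧ a ∈ B.Act ∧ p' ∈ B.Q

/-- The induced labeled transition relation on configurations `(p, C)` with `C` in `ℕ ^ n`. -/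
inductive Step (B : VASS n) : ℕ × (Fin n → ℕ) → ℕ → ℕ × (Fin n → ℕ) → Prop
  | move {p p' a : ℕ} {C C' : Fin n → ℕ} {D : Fin n → SignType}
      (mem : (p, a, p', D) ∈ B.δ) (hC : ∀ i, (C' i : ℤ) = (C i : ℤ) + (D i : ℤ)) :
      Step B (p, C) a (p', C')

end VASS

/-- `R` is a simulation between two labeled transition systems. -/
def IsSimulation {V V' L : Type*} (tr : V → L → V → Prop) (tr' : V' → L → V' → Prop)
    (R : V → V' → Prop) : Prop :=
  ∀ s s', R s s' → ∀ a t, tr s a t → ∃ t', tr' s' a t' ∧ R t t'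

/-- Simulation preorder: `s'` simulates `s`. -/
def Simulates {V V' L : Type*} (tr : V → L → V → Prop) (tr' : V' → L → V' → Prop)
    (s : V) (s' : V') : Prop :=
  ∃ R, IsSimulation tr tr' R ∧ R s s'

/-- Inputs of the problem of simulation between an OCA and an `n`-dimensional VASS: the two
systems, over the same set of action labels, and a configuration of each. -/
structure SimInput (n : ℕ) where
  /-- the automaton -/
  A : OCA
  /-- the vector addition system -/
  B : VASS n
  /-- configuration of the automaton -/
  s : ℕ × ℕ
  /-- configuration of the vector addition system -/
  s' : ℕ × (Fin n → ℕ)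

namespace SimInput

variable {n : ℕ}

/-- An input as the tuple of its components. -/
def equivProd (n : ℕ) : SimInput n ≃ OCA × VASS n × (ℕ × ℕ) × (ℕ × (Fin n → ℕ)) where
  toFun x := (x.A, x.B, x.s, x.s')
  invFun x := ⟨x.1, x.2.1, x.2.2.1, x.2.2.2⟩
  left_inv _ := rfl
  right_inv _ := rfl

instance : Primcodable (SimInput n) := Primcodable.ofEquiv _ (equivProd n)

/-- The input is well-formed. -/
structure Valid (x : SimInput n) : Prop where
  oca : x.A.WellFormed
  vass : x.B.WellFormed
  act : ∀ a, a ∈ x.A.Act ↔ a ∈ x.B.Act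
  state : x.s.1 ∈ x.A.Q
  state' : x.s'.1 ∈ x.B.Q

/-- The configuration of the OCA is simulated by the configuration of the VASS. -/
def Holds (x : SimInput n) : Prop := Simulates x.A.Step x.B.Step x.s x.s'

end SimInput

end InfiniteStateGames

/-!
The halting problem of two-counter machines is reduced to both problems. A single machine `T` is
fixed whose halting is undecidable as a function of the initial value `2 ^ x` of its first counter
(`CounterMachine.exists_machine_undecidable`); the game, the automaton and the vector addition
system are then fixed as well, and only the starting configuration depends on `x`, so that the
reductions are computable for trivial reasons.

*The machine.* Halting of `Nat.Partrec.Code` amounts to the existence of a zero `k` of a primitive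
recursive `g x k`, by means of the bounded evaluator `evaln`. Primitive recursive functions are
computed by programs with finitely many registers (`CounterMachine.regComputable_of_primrec'`).
The registers are kept as the exponents of the primes in one counter, whose multiplication and
division by a constant need only one more counter. Only the outermost search for `k` can run
forever, so no program has to be analysed on inputs on which it does not terminate. Machines have
exits at which they are plugged together by flow charts (`CounterMachine.Machine.link`).

*The game.* The counters of `T` are two components of the energy, and the counter of the game is
their sum. Player 1 runs `T`. It cannot decrement a counter with value zero, as the energy would
become negative. If it falsely claims that a counter is zero, then the other counter is smaller
than the sum, and player 0 wins by decrementing both until the sum is used up. If the claim is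
true, this comparison loses for player 0. At the halting state the energy decreases forever.
Hence player 1 wins iff `T` does not halt: otherwise the starting configuration is in the
attractor of negative energy (`OCEnergyGame.attractor_of_halts`).

*Simulation.* The automaton keeps the sum of the counters of `T`, and the vector addition system
the two counters. To run an instruction that may decrement a counter, the automaton makes a step
that does not reveal the outcome, and the vector addition system answers by a choice of the
outcome. The next action of the automaton has to agree with that choice, because otherwise the
vector addition system enters a state in which it can simulate everything. False claims are
refuted as in the game. When `T` halts, the automaton has a step and the vector addition system
has none.
-/

namespace CounterMachine

/-! ### Two-counter machines with exits -/

/-- Instructions of a machine with two counters that continues at targets of type `τ`. -/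
inductive Instr (τ : Type) : Type
  /-- increment counter `b` and go to `t` -/
  | inc (b : Fin 2) (t : τ)
  /-- decrement counter `b` and go to `t`, or go to `z` if the counter is zero -/
  | dec (b : Fin 2) (t z : τ)

namespace Instr

variable {τ τ' : Type}

/-- Renaming of the targets of an instruction. -/
def map (f : τ → τ') : Instr τ → Instr τ'
  | inc b t => inc b (f t)
  | dec b t z => dec b (f t) (f z)

/-- The effect of an instruction on the counters, and the target at which it continues. -/
def exec (c : Fin 2 → ℕ) : Instr τ → τ × (Fin 2 → ℕ)
  | inc b t => (t, Function.update c b (c b + 1))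
  | dec b t z => if c b = 0 then (z, c) else (t, Function.update c b (c b - 1))

theorem exec_map (f : τ → τ') (I : Instr τ) (c : Fin 2 → ℕ) :
    (I.map f).exec c = (f (I.exec c).1, (I.exec c).2) := by
  cases I <;> simp only [map, exec]
  split_ifs <;> rfl

theorem update_zero (a b x : ℕ) : Function.update ![a, b] 0 x = ![x, b] := by
  ext i; fin_cases i <;> simp

theorem update_one (a b x : ℕ) : Function.update ![a, b] 1 x = ![a, x] := by
  ext i; fin_cases i <;> simp

/-- Exchange of the roles of the two counters. -/
def swap : Instr τ → Instr τ
  | inc b t => inc (1 - b) t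
  | dec b t z => dec (1 - b) t z

theorem exec_swap (I : Instr τ) (c : Fin 2 → ℕ) :
    I.swap.exec ![c 1, c 0] = ((I.exec c).1, ![(I.exec c).2 1, (I.exec c).2 0]) := by
  cases I with
  | inc b t => fin_cases b <;> simp [swap, exec, update_zero, update_one]
  | dec b t z =>
    fin_cases b <;> simp [swap, exec, update_zero, update_one] <;> split_ifs <;> simp

end Instr

open Instr (update_zero update_one)

/-- A two-counter machine. It stops on reaching one of the exits `ε`, so that machines can be
plugged together at their exits. -/
structure Machine (ε : Type) where
  /-- control-states -/
  σ : Type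
  [fin : Finite σ]
  /-- the instruction executed at each control-state -/
  code : σ → Instr (σ ⊕ ε)
  /-- the initial control-state -/
  entry : σ

namespace Machine

variable {ε ε' ι : Type}

/-- Configurations: a control-state or an exit, and the values of the counters. -/
abbrev Cfg (M : Machine ε) : Type := (M.σ ⊕ ε) × (Fin 2 → ℕ)

/-- One step of computation. -/
inductive Step {σ : Type} (code : σ → Instr (σ ⊕ ε)) :
    (σ ⊕ ε) × (Fin 2 → ℕ) → (σ ⊕ ε) × (Fin 2 → ℕ) → Prop
  | mk (s : σ) (c : Fin 2 → ℕ) : Step code (Sum.inl s, c) ((code s).exec c)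

theorem Step.of_exec_eq {σ : Type} {code : σ → Instr (σ ⊕ ε)} {s : σ} {c : Fin 2 → ℕ}
    {y : (σ ⊕ ε) × (Fin 2 → ℕ)} (h : (code s).exec c = y) : Step code (Sum.inl s, c) y :=
  h ▸ .mk s c

/-- Started with counters `c`, the machine reaches the exit `e` with counters `c'`. -/
def Run (M : Machine ε) (c : Fin 2 → ℕ) (e : ε) (c' : Fin 2 → ℕ) : Prop :=
  Relation.TransGen (Step M.code) (Sum.inl M.entry, c) (Sum.inr e, c')

/-- The computation from the given configuration reaches an exit. -/
inductive Halts (M : Machine ε) : M.Cfg → Prop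
  | exit (e : ε) (c : Fin 2 → ℕ) : Halts M (Sum.inr e, c)
  | step (s : M.σ) (c : Fin 2 → ℕ) (h : Halts M ((M.code s).exec c)) : Halts M (Sum.inl s, c)

theorem halts_iff_exec {M : Machine ε} {s : M.σ} {c : Fin 2 → ℕ} :
    M.Halts (Sum.inl s, c) ↔ M.Halts ((M.code s).exec c) :=
  ⟨fun h => by cases h; assumption, Halts.step s c⟩

theorem Halts.of_step {M : Machine ε} {x y : M.Cfg} (h : Step M.code x y) (hy : M.Halts y) :
    M.Halts x := by
  cases h; exact .step _ _ hy

theorem Halts.of_run {M : Machine ε} {c c' : Fin 2 → ℕ} {e : ε} (h : M.Run c e c') :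
    M.Halts (Sum.inl M.entry, c) := by
  exact Relation.TransGen.closed' (P := M.Halts) (fun h hy => .of_step h hy) h (.exit _ _)

/-- A computation that passes again and again through a set of checkpoints does not halt. -/
theorem not_halts_of_checkpoints {M : Machine ε} {S : M.Cfg → Prop}
    (h : ∀ x, S x → ∃ y, S y ∧ Relation.TransGen (Step M.code) x y) {x : M.Cfg} (hx : S x) :
    ¬ M.Halts x := by
  suffices H : ∀ x, M.Halts x → ∀ y, S y → ¬ Relation.ReflTransGen (Step M.code) x y from
    fun h0 => H _ h0 x hx .refl
  have key : ∀ x y, S y → Relation.ReflTransGen (Step M.code) x y →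
      ∃ x' y', S y' ∧ Step M.code x x' ∧ Relation.ReflTransGen (Step M.code) x' y' := by
    intro x y hy hxy
    rcases hxy.cases_head with rfl | ⟨x', h1, h2⟩
    · obtain ⟨y', hy', h'⟩ := h x hy
      obtain ⟨x', h1, h2⟩ := Relation.TransGen.head'_iff.1 h'
      exact ⟨x', y', hy', h1, h2⟩
    · exact ⟨x', y, hy, h1, h2⟩
  intro x hx
  induction hx with
  | exit e c =>
    intro y hy hxy
    obtain ⟨_, _, _, h1, _⟩ := key _ _ hy hxy
    cases h1
  | step s c _ ih =>
    intro y hy hxy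
    obtain ⟨x', y', hy', h1, h2⟩ := key _ _ hy hxy
    cases h1
    exact ih y' hy' h2

/-! ### Plugging machines together -/

/-- The machine with a single instruction. -/
def single (I : Instr ε) : Machine ε where
  σ := Unit
  code _ := I.map Sum.inr
  entry := ()

theorem run_single (I : Instr ε) (c : Fin 2 → ℕ) :
    (single I).Run c (I.exec c).1 (I.exec c).2 := by
  exact .single (.of_exec_eq (code := (single I).code) (Instr.exec_map _ _ _))

/-- The control-state of a linked machine at which one of its parts continues. -/
def linkTarget (F : ι → Machine (ι ⊕ ε)) (i : ι) : (F i).σ ⊕ (ι ⊕ ε) → (Σ i, (F i).σ) ⊕ ε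
  | .inl s => .inl ⟨i, s⟩
  | .inr (.inl j) => .inl ⟨j, (F j).entry⟩
  | .inr (.inr e) => .inr e

/-- A flow chart whose nodes are machines: each exit of a node leads to a node or out of the
chart. -/
def link [Finite ι] (F : ι → Machine (ι ⊕ ε)) (i : ι) : Machine ε where
  σ := Σ i, (F i).σ
  fin := haveI := fun i => (F i).fin; inferInstance
  code s := ((F s.1).code s.2).map (linkTarget F s.1)
  entry := ⟨i, (F i).entry⟩

section link

variable [Finite ι] {F : ι → Machine (ι ⊕ ε)} {i j k : ι} {c c' c'' : Fin 2 → ℕ} {e : ε}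

theorem transGen_link {t : ι ⊕ ε} (h : (F i).Run c t c') :
    Relation.TransGen (Step (link F k).code) (Sum.inl ⟨i, (F i).entry⟩, c)
      (linkTarget F i (Sum.inr t), c') := by
  refine Relation.TransGen.lift (fun x : (F i).Cfg => (linkTarget F i x.1, x.2)) ?_ _ _ h
  rintro _ _ ⟨s, c⟩
  exact .of_exec_eq (code := (link F k).code) (Instr.exec_map _ _ _)

theorem run_link_exit (h : (F i).Run c (Sum.inr e) c') : (link F i).Run c e c' :=
  transGen_link h

theorem run_link_next (h : (F i).Run c (Sum.inl j) c') (h' : (link F j).Run c' e c'') :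
    (link F i).Run c e c'' :=
  Relation.TransGen.trans (transGen_link (k := i) h) h'

end link

/-- Renaming of exits. -/
def mapExit (f : ε → ε') (M : Machine ε) : Machine ε' where
  σ := M.σ
  fin := M.fin
  code s := (M.code s).map (Sum.map id f)
  entry := M.entry

theorem Run.mapExit {M : Machine ε} {c c' : Fin 2 → ℕ} {e : ε} (h : M.Run c e c') (f : ε → ε') :
    (M.mapExit f).Run c (f e) c' := by
  refine Relation.TransGen.lift (fun x : M.Cfg => (Sum.map id f x.1, x.2)) ?_ _ _ h
  rintro _ _ ⟨s, c⟩
  exact .of_exec_eq (code := (M.mapExit f).code) (Instr.exec_map _ _ _)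

/-- Sequential composition, with a continuation for each exit of the first machine. -/
def bind [Finite ε] (M : Machine ε) (N : ε → Machine ε') : Machine ε' :=
  link (fun i : Option ε => match i with
    | none => M.mapExit fun e => Sum.inl (some e)
    | some e => (N e).mapExit Sum.inr) none

theorem Run.bind [Finite ε] {M : Machine ε} {N : ε → Machine ε'} {c c' c'' : Fin 2 → ℕ} {e : ε}
    {e' : ε'} (h : M.Run c e c') (h' : (N e).Run c' e' c'') : (M.bind N).Run c e' c'' :=
  run_link_next (j := some e) (h.mapExit fun e => Sum.inl (some e))
    (run_link_exit (h'.mapExit Sum.inr))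

/-- The machine that is restarted whenever it reaches the exit `none`. -/
def iter (M : Machine (Option ε)) : Machine ε :=
  link (fun _ : Unit => M.mapExit fun e => e.elim (Sum.inl ()) Sum.inr) ()

theorem Run.iter_exit {M : Machine (Option ε)} {c c' : Fin 2 → ℕ} {e : ε}
    (h : M.Run c (some e) c') : M.iter.Run c e c' :=
  run_link_exit (h.mapExit fun e => e.elim (Sum.inl ()) Sum.inr)

theorem Run.iter_next {M : Machine (Option ε)} {c c' c'' : Fin 2 → ℕ} {e : ε}
    (h : M.Run c none c') (h' : M.iter.Run c' e c'') : M.iter.Run c e c'' :=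
  run_link_next (h.mapExit fun e => e.elim (Sum.inl ()) Sum.inr) h'

theorem iter_not_halts {M : Machine (Option ε)} {S : (Fin 2 → ℕ) → Prop}
    (h : ∀ c, S c → ∃ c', S c' ∧ M.Run c none c') {c : Fin 2 → ℕ} (hc : S c) :
    ¬ M.iter.Halts (Sum.inl M.iter.entry, c) := by
  refine not_halts_of_checkpoints (S := fun x => x.1 = Sum.inl M.iter.entry ∧ S x.2) ?_ ⟨rfl, hc⟩
  rintro ⟨_, c⟩ ⟨rfl, hc⟩
  obtain ⟨c', hc', hr⟩ := h c hc
  have := transGen_link (F := fun _ : Unit => M.mapExit fun e => e.elim (Sum.inl ()) Sum.inr)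
    (i := ()) (k := ()) (hr.mapExit fun e => e.elim (Sum.inl ()) Sum.inr)
  exact ⟨(Sum.inl M.iter.entry, c'), ⟨rfl, hc'⟩, this⟩

/-! ### Multiplication and division of a counter by a constant -/

/-- The first counter is increased by `k + 1`. -/
theorem exists_add (k : ℕ) : ∃ M : Machine Unit, ∀ a b, M.Run ![a, b] () ![a + (k + 1), b] := by
  induction k with
  | zero => exact ⟨single (.inc 0 ()), fun a b => by
      simpa [Instr.exec, update_zero] using run_single (.inc 0 ()) ![a, b]⟩
  | succ k ih =>
    obtain ⟨M, hM⟩ := ih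
    refine ⟨M.bind fun _ => single (.inc 0 ()), fun a b => (hM a b).bind ?_⟩
    simpa [Instr.exec, update_zero, add_assoc] using run_single (.inc 0 ()) ![a + (k + 1), b]

/-- Exchange of the roles of the two counters. -/
def swap (M : Machine ε) : Machine ε where
  σ := M.σ
  fin := M.fin
  code s := (M.code s).swap
  entry := M.entry

theorem Run.swap {M : Machine ε} {a b a' b' : ℕ} {e : ε} (h : M.Run ![a, b] e ![a', b']) :
    M.swap.Run ![b, a] e ![b', a'] := by
  refine Relation.TransGen.lift (p := Step M.swap.code)
    (fun x : M.Cfg => (x.1, ![x.2 1, x.2 0])) ?_ _ _ h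
  rintro _ _ ⟨s, c⟩
  exact .of_exec_eq (code := M.swap.code) (Instr.exec_swap _ _)

/-- The second counter is emptied, and `k + 1` times its value is added to the first. -/
theorem exists_transfer (k : ℕ) :
    ∃ M : Machine Unit, ∀ a b, M.Run ![a, b] () ![a + (k + 1) * b, 0] := by
  obtain ⟨A, hA⟩ := exists_add k
  -- When the second counter is empty, the exit is reached through `inc 0; dec 0`.
  refine ⟨iter (bind (single (.dec 1 true false)) fun e =>
    if e then A.mapExit fun _ => none else (single (.inc 0 ())).bind fun _ =>
      single (.dec 0 (some ()) (some ()))), fun a b => ?_⟩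
  induction b generalizing a with
  | zero =>
    refine Run.iter_exit (Run.bind (e := false) (c' := ![a, 0]) ?_
      (Run.bind (e := ()) (c' := ![a + 1, 0]) ?_ ?_))
    · simpa [Instr.exec] using run_single (.dec 1 true false) ![a, 0]
    · simpa [Instr.exec, update_zero] using run_single (.inc 0 ()) ![a, 0]
    · simpa [Instr.exec, update_zero] using
        run_single (.dec 0 (some ()) (some ())) ![a + 1, 0]
  | succ b ih =>
    refine Run.iter_next (c' := ![a + (k + 1), b]) (Run.bind (e := true) (c' := ![a, b]) ?_ ?_) ?_
    · simpa [Instr.exec, update_one] using run_single (.dec 1 true false) ![a, b + 1]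
    · exact (hA a b).mapExit _
    · convert ih (a + (k + 1)) using 2
      ring

/-- Multiplication of the first counter by `k + 1`. -/
theorem exists_mul (k : ℕ) : ∃ M : Machine Unit, ∀ a, M.Run ![a, 0] () ![a * (k + 1), 0] := by
  obtain ⟨A, hA⟩ := exists_transfer 0
  obtain ⟨B, hB⟩ := exists_transfer k
  refine ⟨A.swap.bind fun _ => B, fun a => Run.bind (e := ()) (c' := ![0, a]) ?_ ?_⟩
  · simpa using (hA 0 a).swap
  · simpa [mul_comm] using hB 0 a

/-- The quotient of the first counter by `p + 1` is moved to the second, and the exit is the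
remainder. -/
theorem exists_divMod (p : ℕ) : ∃ M : Machine (Fin (p + 1)), ∀ a,
    M.Run ![a, 0] (Fin.ofNat (p + 1) a) ![0, a / (p + 1)] := by
  -- Node `j` is visited when `j` units of an incomplete block of `p + 1` have been removed.
  let F : Fin (p + 1) → Machine (Fin (p + 1) ⊕ Fin (p + 1)) := fun j =>
    bind (single (.dec 0 true false)) fun e =>
      if e then
        if j.1 < p then (single (.inc 1 ())).bind fun _ =>
          single (.dec 1 (Sum.inl (j + 1)) (Sum.inl (j + 1)))
        else single (.inc 1 (Sum.inl 0))
      else (single (.inc 1 ())).bind fun _ => single (.dec 1 (Sum.inr j) (Sum.inr j))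
  -- A jump is programmed as the two instructions `inc 1; dec 1`, as exits are reached only by
  -- instructions.
  have nop : ∀ (a b : ℕ) (t : Fin (p + 1) ⊕ Fin (p + 1)),
      ((single (.inc 1 ())).bind fun _ => single (.dec 1 t t)).Run ![a, b] t ![a, b] := by
    intro a b t
    refine Run.bind (e := ()) (c' := ![a, b + 1]) ?_ ?_
    · simpa [Instr.exec, update_one] using run_single (.inc 1 ()) ![a, b]
    · simpa [Instr.exec, update_one] using run_single (.dec 1 t t) ![a, b + 1]
  have key : ∀ (a b : ℕ) (j : Fin (p + 1)),
      (link F j).Run ![a, b] (Fin.ofNat (p + 1) (j + a)) ![0, b + (j + a) / (p + 1)] := by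
    intro a
    induction a with
    | zero =>
      intro b j
      have : Fin.ofNat (p + 1) (j + 0) = j := by ext; simp [Fin.ofNat, Nat.mod_eq_of_lt j.2]
      rw [this, add_zero, Nat.div_eq_of_lt j.2]
      refine run_link_exit (Run.bind (e := false) (c' := ![0, b]) ?_ ?_)
      · simpa [Instr.exec] using run_single (.dec 0 true false) ![0, b]
      · exact nop 0 b _
    | succ a ih =>
      intro b j
      have h1 : (single (.dec 0 true false)).Run ![a + 1, b] true ![a, b] := by
        simpa [Instr.exec, update_zero] using run_single (.dec 0 true false) ![a + 1, b]
      by_cases hj : j.1 < p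
      · have hj' : (j + 1).1 = j.1 + 1 := Fin.val_add_one_of_lt (by simpa [Fin.lt_def] using hj)
        convert run_link_next (F := F) (j := j + 1) (c' := ![a, b]) (Run.bind h1 ?_)
          (ih b (j + 1)) using 1
        · rw [hj']; congr 1; ring
        · rw [hj']; congr 4; ring
        · simpa [hj] using nop a b _
      · have hj' : j.1 = p := by omega
        convert run_link_next (F := F) (j := 0) (c' := ![a, b + 1]) (Run.bind h1 ?_)
          (ih (b + 1) 0) using 1
        · ext; simp only [Fin.ofNat, hj', Fin.val_zero]
          rw [show p + (a + 1) = 0 + a + (p + 1) by ring, Nat.add_mod_right]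
        · rw [hj', show p + (a + 1) = a + (p + 1) by ring, Nat.add_div_right _ (by omega)]
          simp only [Fin.val_zero, zero_add]
          congr 2; omega
        · simpa [hj, Instr.exec, update_one] using run_single (.inc 1 (Sum.inl 0)) ![a, b]
  exact ⟨link F 0, fun a => by simpa using key a 0 0⟩

/-- Division of the first counter by `p + 1` if it is divisible; otherwise it is left as it is. -/
theorem exists_div (p : ℕ) : ∃ M : Machine Bool, ∀ a,
    (p + 1 ∣ a → M.Run ![a, 0] true ![a / (p + 1), 0]) ∧
      (¬ p + 1 ∣ a → M.Run ![a, 0] false ![a, 0]) := by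
  obtain ⟨D, hD⟩ := exists_divMod p
  obtain ⟨T, hT⟩ := exists_transfer 0
  obtain ⟨B, hB⟩ := exists_transfer p
  choose A hA using exists_add
  refine ⟨D.bind fun j => if j = 0 then T.mapExit fun _ => true else
    (A (j - 1)).bind fun _ => B.mapExit fun _ => false, fun a => ⟨fun h => ?_, fun h => ?_⟩⟩
  · have h0 : Fin.ofNat (p + 1) a = 0 := by ext; simpa [Fin.ofNat] using Nat.mod_eq_zero_of_dvd h
    refine (hD a).bind ?_
    rw [if_pos h0]
    simpa using (hT 0 (a / (p + 1))).mapExit fun _ => true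
  · have hm : a % (p + 1) ≠ 0 := fun h' => h (Nat.dvd_of_mod_eq_zero h')
    have h0 : Fin.ofNat (p + 1) a ≠ 0 := fun h' => hm (by simpa [Fin.ofNat] using congrArg Fin.val h')
    refine (hD a).bind ?_
    rw [if_neg h0]
    refine (hA _ 0 _).bind ?_
    convert (hB _ (a / (p + 1))).mapExit fun _ => false using 2
    have := Nat.mod_add_div a (p + 1)
    simp only [Fin.ofNat]
    omega

end Machine

end CounterMachine

namespace CounterMachine

open Machine Function

/-! ### Registers encoded by prime exponents -/

/-- The counters `c` represent the registers `r`: the second counter is zero, and the value of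
register `i` is the exponent of the `i`-th prime in the first. -/
structure Represents (r : ℕ → ℕ) (c : Fin 2 → ℕ) : Prop where
  ne_zero : c 0 ≠ 0
  zero : c 1 = 0
  factorization : ∀ i, (c 0).factorization (Nat.nth Nat.Prime i) = r i

theorem prime_nth (i : ℕ) : (Nat.nth Nat.Prime i).Prime := Nat.prime_nth_prime i

theorem factorization_nth (i j : ℕ) :
    (Nat.nth Nat.Prime i).factorization (Nat.nth Nat.Prime j) = if j = i then 1 else 0 := by
  rw [(prime_nth i).factorization, Finsupp.single_apply]
  simp [(Nat.nth_injective Nat.infinite_setOfPred_prime).eq_iff, eq_comm]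

/-- On all registers `r` and all their representations, `M` reaches the exit `e` with registers
`r'`. -/
def RegRun {ε : Type} (M : Machine ε) (r : ℕ → ℕ) (e : ε) (r' : ℕ → ℕ) : Prop :=
  ∀ c, Represents r c → ∃ c', Represents r' c' ∧ M.Run c e c'

section RegRun

variable {ε ε' : Type} {r r' r'' : ℕ → ℕ}

theorem RegRun.bind [Finite ε] {M : Machine ε} {N : ε → Machine ε'} {e : ε} {e' : ε'}
    (h : RegRun M r e r') (h' : RegRun (N e) r' e' r'') : RegRun (M.bind N) r e' r'' := by
  intro c hc
  obtain ⟨c', hc', h1⟩ := h c hc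
  obtain ⟨c'', hc'', h2⟩ := h' c' hc'
  exact ⟨c'', hc'', h1.bind h2⟩

theorem RegRun.mapExit {M : Machine ε} {e : ε} (h : RegRun M r e r') (f : ε → ε') :
    RegRun (M.mapExit f) r (f e) r' := by
  intro c hc
  obtain ⟨c', hc', h1⟩ := h c hc
  exact ⟨c', hc', h1.mapExit f⟩

theorem RegRun.iter_exit {M : Machine (Option ε)} {e : ε} (h : RegRun M r (some e) r') :
    RegRun M.iter r e r' := by
  intro c hc
  obtain ⟨c', hc', h1⟩ := h c hc
  exact ⟨c', hc', h1.iter_exit⟩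

theorem RegRun.iter_next {M : Machine (Option ε)} {e : ε} (h : RegRun M r none r')
    (h' : RegRun M.iter r' e r'') : RegRun M.iter r e r'' := by
  intro c hc
  obtain ⟨c', hc', h1⟩ := h c hc
  obtain ⟨c'', hc'', h2⟩ := h' c' hc'
  exact ⟨c'', hc'', h1.iter_next h2⟩

theorem exists_reg_inc (i : ℕ) :
    ∃ M : Machine Unit, ∀ r, RegRun M r () (update r i (r i + 1)) := by
  obtain ⟨M, hM⟩ := exists_mul (Nat.nth Nat.Prime i - 1)
  have hp : Nat.nth Nat.Prime i - 1 + 1 = Nat.nth Nat.Prime i :=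
    Nat.sub_add_cancel (prime_nth i).one_le
  refine ⟨M, fun r c hc => ?_⟩
  have h := hM (c 0)
  rw [hp] at h
  have hc0 : ![c 0, 0] = c := by ext k; fin_cases k <;> simp [hc.zero]
  rw [hc0] at h
  refine ⟨_, ⟨?_, rfl, fun j => ?_⟩, h⟩
  · simpa [hc.ne_zero] using (prime_nth i).ne_zero
  · simp only [Matrix.cons_val_zero]
    rw [Nat.factorization_mul hc.ne_zero (prime_nth i).ne_zero, Finsupp.add_apply,
      hc.factorization, factorization_nth, update_apply]
    split_ifs with hj
    · rw [hj]
    · rfl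

theorem exists_reg_dec (i : ℕ) : ∃ M : Machine Bool, ∀ r,
    (r i = 0 → RegRun M r false r) ∧ (r i ≠ 0 → RegRun M r true (update r i (r i - 1))) := by
  obtain ⟨M, hM⟩ := exists_div (Nat.nth Nat.Prime i - 1)
  have hp : Nat.nth Nat.Prime i - 1 + 1 = Nat.nth Nat.Prime i :=
    Nat.sub_add_cancel (prime_nth i).one_le
  rw [hp] at hM
  have hc0 : ∀ {r c}, Represents r c → ![c 0, 0] = c := fun hc => by
    ext k; fin_cases k <;> simp [hc.zero]
  have hdvd : ∀ {r c}, Represents r c → (Nat.nth Nat.Prime i ∣ c 0 ↔ r i ≠ 0) := by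
    intro r c hc
    rw [← hc.factorization, (prime_nth i).dvd_iff_one_le_factorization hc.ne_zero]
    omega
  refine ⟨M, fun r => ⟨fun h c hc => ⟨c, hc, ?_⟩, fun h c hc => ?_⟩⟩
  · have := (hM (c 0)).2 fun h' => (hdvd hc).1 h' h
    rwa [hc0 hc] at this
  · have hd := (hdvd hc).2 h
    have := (hM (c 0)).1 hd
    rw [hc0 hc] at this
    refine ⟨_, ⟨?_, rfl, fun j => ?_⟩, this⟩
    · exact (Nat.div_pos (Nat.le_of_dvd (Nat.pos_of_ne_zero hc.ne_zero) hd)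
        (prime_nth i).pos).ne'
    · simp only [Matrix.cons_val_zero]
      rw [Nat.factorization_div hd, Finsupp.coe_tsub, Pi.sub_apply, hc.factorization,
        factorization_nth, update_apply]
      split_ifs with hj
      · rw [hj]
      · rfl

end RegRun

/-! ### Programs on registers -/

/-- Some machine transforms all registers `r` with `P r` to `F r`. -/
def Programmable (P : (ℕ → ℕ) → Prop) (F : (ℕ → ℕ) → ℕ → ℕ) : Prop :=
  ∃ M : Machine Unit, ∀ r, P r → RegRun M r () (F r)

namespace Programmable

variable {P Q : (ℕ → ℕ) → Prop} {F G : (ℕ → ℕ) → ℕ → ℕ}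

theorem congr (h : Programmable P F) (hQ : ∀ r, Q r → P r) (hF : ∀ r, Q r → F r = G r) :
    Programmable Q G := by
  obtain ⟨M, hM⟩ := h
  exact ⟨M, fun r hr => hF r hr ▸ hM r (hQ r hr)⟩

theorem comp (h : Programmable P F) (h' : Programmable Q G) (hP : ∀ r, P r → Q (F r)) :
    Programmable P fun r => G (F r) := by
  obtain ⟨M, hM⟩ := h
  obtain ⟨N, hN⟩ := h'
  exact ⟨M.bind fun _ => N, fun r hr => (hM r hr).bind (hN _ (hP r hr))⟩

theorem inc (P) (i : ℕ) : Programmable P fun r => update r i (r i + 1) := by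
  obtain ⟨M, hM⟩ := exists_reg_inc i
  exact ⟨M, fun r _ => hM r⟩

/-- The loop that, as long as register `i` is not zero, decrements it and executes a program for
`F`. The hypotheses describe the result `G` of the loop by recursion. -/
theorem loop (i : ℕ) (h : Programmable P F) (h0 : ∀ r, Q r → r i = 0 → G r = r)
    (hs : ∀ r, Q r → r i ≠ 0 → P (update r i (r i - 1)) ∧ Q (F (update r i (r i - 1))) ∧
      F (update r i (r i - 1)) i = r i - 1 ∧ G (F (update r i (r i - 1))) = G r) :
    Programmable Q G := by
  obtain ⟨M, hM⟩ := h
  obtain ⟨D, hD⟩ := exists_reg_dec i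
  -- The exit `some ()` has to be reached by a program: the two steps `inc i; dec i`.
  obtain ⟨I, hI⟩ := exists_reg_inc i
  refine ⟨iter (D.bind fun b => if b then M.mapExit fun _ => none else
    I.bind fun _ => D.mapExit fun _ => some ()), ?_⟩
  suffices H : ∀ n r, Q r → r i = n → RegRun _ r () (G r) from fun r hr => H _ r hr rfl
  intro n
  induction n with
  | zero =>
    intro r hr hn
    rw [h0 r hr hn]
    refine RegRun.iter_exit (RegRun.bind ((hD r).1 hn) (RegRun.bind (hI r) ?_))
    have := ((hD (update r i (r i + 1))).2 (by simp)).mapExit fun _ => some ()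
    simpa using this
  | succ n ih =>
    intro r hr hn
    obtain ⟨h1, h2, h3, h4⟩ := hs r hr (by omega)
    refine RegRun.iter_next (RegRun.bind ((hD r).2 (by omega)) ((hM _ h1).mapExit _)) ?_
    rw [← h4]
    exact ih _ h2 (by omega)

theorem skip (P) : Programmable P fun r => r := by
  obtain ⟨I, hI⟩ := exists_reg_inc 0
  obtain ⟨D, hD⟩ := exists_reg_dec 0
  refine ⟨I.bind fun _ => D.mapExit fun _ => (), fun r _ => (hI r).bind ?_⟩
  have := ((hD (update r 0 (r 0 + 1))).2 (by simp)).mapExit fun _ => ()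
  simpa using this

theorem clear (P) (i : ℕ) : Programmable P fun r => update r i 0 := by
  refine (loop i (skip fun _ => True) (Q := fun _ => True) (fun r _ h => ?_)
    fun r _ h => ⟨trivial, trivial, ?_, ?_⟩).congr (fun _ _ => trivial) fun _ _ => rfl
  · rw [← h, update_eq_self]
  · simp
  · simp

/-- Register `i` is emptied, and its value is added to register `j`. -/
theorem move (P) {i j : ℕ} (hij : i ≠ j) :
    Programmable P fun r => update (update r i 0) j (r j + r i) := by
  refine (loop i (inc (fun _ => True) j) (Q := fun _ => True) (fun r _ h => ?_)
    fun r _ h => ⟨trivial, trivial, ?_, ?_⟩).congr (fun _ _ => trivial) fun _ _ => rfl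
  · ext k; simp only [update_apply]; grind
  · simp only [update_apply]; grind
  · ext k; simp only [update_apply]; grind

/-- The value of register `i` is added to register `j`, with the help of register `t`. -/
theorem copy {i j t : ℕ} (hij : i ≠ j) (hit : i ≠ t) (hjt : j ≠ t) :
    Programmable (fun r => r t = 0) fun r => update r j (r j + r i) := by
  have h1 : Programmable (fun r => r t = 0) fun r =>
      update (update (update r i 0) t (r t + r i)) j (r j + r i) := by
    refine (loop i ((inc (fun _ => True) t).comp (inc (fun _ => True) j) fun _ _ => trivial)
      (Q := fun _ => True) (fun r _ h => ?_)
      fun r _ h => ⟨trivial, trivial, ?_, ?_⟩).congr (fun _ _ => trivial) fun _ _ => rfl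
    · ext k; simp only [update_apply]; grind
    · simp only [update_apply]; grind
    · ext k; simp only [update_apply]; grind
  refine (h1.comp (move (fun _ => True) hit.symm) fun _ _ => trivial).congr (fun _ h => h)
    fun r h => ?_
  ext k; simp only [update_apply]; grind

theorem clear_range (P) (b k : ℕ) :
    Programmable P fun r j => if b ≤ j ∧ j < b + k then 0 else r j := by
  induction k with
  | zero => exact (skip P).congr (fun _ h => h) fun r _ => by ext j; grind
  | succ k ih =>
    refine (ih.comp (clear (fun _ => True) (b + k)) fun _ _ => trivial).congr (fun _ h => h)
      fun r h => ?_
    ext j; simp only [update_apply]; grind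

end Programmable

/-! ### Programs for primitive recursive functions -/

/-- All registers from `b` on are zero. -/
def Fresh (b : ℕ) (r : ℕ → ℕ) : Prop := ∀ j, b ≤ j → r j = 0

/-- Whatever registers below `b` hold the arguments of `f`, some program stores the value of `f`
in register `b` and leaves the other registers as they are, provided that all registers from `b`
on are zero at the start. -/
def RegComputable {n : ℕ} (f : List.Vector ℕ n → ℕ) : Prop :=
  ∀ (b : ℕ) (a : Fin n → ℕ), (∀ i, a i < b) →
    Programmable (Fresh b) fun r => update r b (f (List.Vector.ofFn fun i => r (a i)))

namespace RegComputable

open Programmable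

theorem zero : RegComputable (n := 0) fun _ => 0 := fun b _ _ => clear _ b

theorem get {n : ℕ} (i : Fin n) : RegComputable fun v => v.get i := by
  intro b a ha
  refine (copy (i := a i) (j := b) (t := b + 1) (ha i).ne (by have := ha i; omega)
    (by omega)).congr (fun r hr => hr _ (by omega)) fun r hr => ?_
  simp [hr b le_rfl]

theorem succ : RegComputable (n := 1) fun v => Nat.succ v.head := by
  intro b a ha
  refine ((get 0 b a ha).comp (inc (fun _ => True) b) fun _ _ => trivial).congr
    (fun r hr => hr) fun r hr => ?_
  simp

theorem comp {m n : ℕ} {f : List.Vector ℕ n → ℕ} (g : Fin n → List.Vector ℕ m → ℕ)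
    (hf : RegComputable f) (hg : ∀ i, RegComputable (g i)) :
    RegComputable fun a => f (List.Vector.ofFn fun i => g i a) := by
  intro b a ha
  -- The values of the `g i` are stored in the registers `b + i`, and that of `f` in `b + n + 1`.
  have h1 : ∀ k ≤ n, Programmable (Fresh b) fun r j =>
      if h : b ≤ j ∧ j < b + k ∧ j < b + n then
        g ⟨j - b, by omega⟩ (List.Vector.ofFn fun i => r (a i)) else r j := by
    intro k
    induction k with
    | zero => exact fun _ => (skip _).congr (fun _ h => h) fun r _ => by ext j; grind
    | succ k ih =>
      intro hk
      refine ((ih (by omega)).comp (hg ⟨k, hk⟩ (b + k) a fun i => by have := ha i; omega)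
        fun r hr j hj => ?_).congr (fun _ h => h) fun r h => ?_
      · rw [dif_neg (by omega)]
        exact hr j (by omega)
      · have : ∀ i, ¬ b ≤ a i := fun i => (ha i).not_ge
        ext j
        simp only [update_apply, this, false_and, dite_false]
        by_cases hj : j = b + k
        · subst hj
          simp; omega
        · grind
  refine (((h1 n le_rfl).comp (hf (b + n + 1) (fun i => b + i) fun i => by omega)
    fun r hr j hj => ?_).comp ((clear_range (fun _ => True) b n).comp (move (fun _ => True)
      (i := b + n + 1) (j := b) (by omega)) fun _ _ => trivial) fun _ _ => trivial).congr
    (fun _ h => h) fun r hr => ?_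
  · rw [dif_neg (by omega)]
    exact hr j (by omega)
  · ext j
    have hb := hr b le_rfl
    have hbn := hr (b + n) (by omega)
    have hbn1 := hr (b + n + 1) (by omega)
    have h2 : ∀ i : Fin n, b ≤ b + i.1 ∧ b + i.1 < b + n ∧ b + i.1 < b + n := fun i => by omega
    have hj' := hr j
    simp only [update_apply, h2, dite_true, Nat.add_sub_cancel_left, and_self]
    grind

theorem prec {n : ℕ} {f : List.Vector ℕ n → ℕ} {g : List.Vector ℕ (n + 2) → ℕ}
    (hf : RegComputable f) (hg : RegComputable g) :
    RegComputable fun v : List.Vector ℕ (n + 1) =>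
      v.head.rec (f v.tail) fun y IH => g (y ::ᵥ IH ::ᵥ v.tail) := by
  intro b a ha
  -- Register `b` holds the last value, `b + 1` the number of iterations done, and `b + 2` the
  -- number of iterations to do.
  let tl : (ℕ → ℕ) → List.Vector ℕ n := fun r => List.Vector.ofFn fun i => r (a i.succ)
  let H : (ℕ → ℕ) → ℕ → ℕ := fun r k => k.rec (f (tl r)) fun y IH => g (y ::ᵥ IH ::ᵥ tl r)
  have hH0 : ∀ r, H r 0 = f (tl r) := fun _ => rfl
  have hH : ∀ r k, H r (k + 1) = g (k ::ᵥ H r k ::ᵥ tl r) := fun _ _ => rfl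
  have hHa : ∀ r, (fun v : List.Vector ℕ (n + 1) => v.head.rec (f v.tail)
      fun y IH => g (y ::ᵥ IH ::ᵥ v.tail)) (List.Vector.ofFn fun i => r (a i)) = H r (r (a 0)) := by
    intro r
    have h1 : (List.Vector.ofFn fun i => r (a i)).tail = tl r := by simp [tl]
    have h2 : (List.Vector.ofFn fun i => r (a i)).head = r (a 0) := by simp
    simp only [h1, h2, H]
  have htl : ∀ r r', (∀ j < b, r' j = r j) → tl r' = tl r := fun r r' h => by
    simp only [tl]; congr 1; funext i; exact h _ (ha _)
  have hHr : ∀ r r', (∀ j < b, r' j = r j) → H r' = H r := fun r r' h => by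
    simp only [H, htl r r' h]
  have hbody : Programmable (Fresh (b + 3)) fun r =>
      update (update r b (g (r (b + 1) ::ᵥ r b ::ᵥ tl r))) (b + 1) (r (b + 1) + 1) := by
    refine ((hg (b + 3) (Fin.cons (b + 1) (Fin.cons b fun i => a i.succ)) ?_).comp
      ((clear (fun _ => True) b).comp ((move (fun _ => True) (i := b + 3) (j := b)
        (by omega)).comp (inc (fun _ => True) (b + 1)) fun _ _ => trivial) fun _ _ => trivial)
      fun _ _ => trivial).congr (fun _ h => h) fun r hr => ?_
    · intro i
      refine Fin.cases ?_ (fun i => Fin.cases ?_ (fun i => ?_) i) i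
      · simp
      · simp
      · have := ha i.succ; simp; omega
    · have hb := hr (b + 3) le_rfl
      ext j
      simp only [update_apply, List.Vector.ofFn, Fin.cons_zero, Fin.cons_succ]
      grind
  have hfa : ∀ r, f (List.Vector.ofFn fun i => r (a i.succ)) = f (tl r) := fun _ => rfl
  clear_value H tl
  have hloop : Programmable (fun r => Fresh (b + 3) r ∧ r b = H r (r (b + 1))) fun r =>
      update (update (update r b (H r (r (b + 1) + r (b + 2)))) (b + 1)
        (r (b + 1) + r (b + 2))) (b + 2) 0 := by
    refine loop (b + 2) hbody (fun r hr h0 => ?_) fun r hr h0 => ?_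
    · ext j; simp only [update_apply, h0, add_zero, ← hr.2]; grind
    · have e1 : ∀ r' : ℕ → ℕ, (∀ j < b, r' j = r j) → tl r' = tl r ∧ H r' = H r :=
        fun r' h => ⟨htl r r' h, hHr r r' h⟩
      obtain ⟨e2, -⟩ := e1 (update r (b + 2) (r (b + 2) - 1)) fun j hj =>
        update_of_ne (by omega) _ _
      rw [e2]
      obtain ⟨-, e3⟩ := e1 (update (update (update r (b + 2) (r (b + 2) - 1)) b
        (g (update r (b + 2) (r (b + 2) - 1) (b + 1) ::ᵥ
          update r (b + 2) (r (b + 2) - 1) b ::ᵥ tl r))) (b + 1)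
        (update r (b + 2) (r (b + 2) - 1) (b + 1) + 1)) fun j hj => by
          simp only [update_apply]; grind
      rw [e3]
      clear e1 e2 e3 htl hHr hHa
      refine ⟨fun j hj => ?_, ⟨fun j hj => ?_, ?_⟩, ?_, ?_⟩
      · have := hr.1 j hj; simp only [update_apply]; grind
      · have := hr.1 j hj; simp only [update_apply]; grind
      · have := hr.2; have := hH r (r (b + 1)); simp only [update_apply]; grind
      · simp only [update_apply]; grind
      · ext j
        have : r (b + 1) + 1 + (r (b + 2) - 1) = r (b + 1) + r (b + 2) := by omega
        simp only [update_apply]; grind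
  refine (((hf b (fun i => a i.succ) fun i => ha _).comp (copy (i := a 0) (j := b + 2)
    (t := b + 3) (by have := ha 0; omega) (by have := ha 0; omega) (by omega))
    fun r hr => ?_).comp (hloop.comp (clear (fun _ => True) (b + 1)) fun _ _ => trivial)
    fun r hr => ⟨fun j hj => ?_, ?_⟩).congr (fun _ h => h) fun r hr => ?_
  · have := hr (b + 3) (by omega)
    simp only [update_apply]; grind
  · have := hr j (by omega)
    simp only [update_apply]; grind
  · have h1 := hr (b + 1) (by omega)
    rw [hHr r _ fun j hj => by simp only [update_apply]; grind]
    have h2 := hH0 r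
    simp only [update_apply]; grind
  · have h0 := hr b (by omega)
    have h1 := hr (b + 1) (by omega)
    have h2 := hr (b + 2) (by omega)
    have ha0 := ha 0
    rw [hHr r _ fun j hj => by simp only [update_apply]; grind]
    rw [hHa]
    ext j
    simp only [update_apply]
    grind

end RegComputable

theorem regComputable_of_primrec' {n : ℕ} {f : List.Vector ℕ n → ℕ} (h : Nat.Primrec' f) :
    RegComputable f := by
  induction h with
  | zero => exact .zero
  | succ => exact .succ
  | get i => exact .get i
  | comp g _ _ hf hg => exact .comp g hf hg
  | prec _ _ hf hg => exact .prec hf hg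

end CounterMachine

namespace CounterMachine

open Machine Function

/-! ### A two-counter machine with undecidable halting problem -/

/-- The halting problem, in the form of a search for a zero of a primitive recursive function. -/
theorem exists_primrec_undecidable : ∃ g : ℕ → ℕ → ℕ, Primrec₂ g ∧
    ¬ ComputablePred fun x => ∃ k, g x k = 0 := by
  open Nat.Partrec.Code in
  refine ⟨fun x k => ((evaln k (Denumerable.ofNat Nat.Partrec.Code x) 0).map fun _ => 0).getD 1,
    ?_, fun h => ComputablePred.halting_problem 0 ?_⟩
  · refine Primrec.option_getD.comp (Primrec.option_map (primrec_evaln.comp ((Primrec.snd.pair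
      ((Primrec.ofNat _).comp .fst)).pair (.const 0))) (.const 0)) (.const 1)
  · obtain ⟨f, hf, h⟩ := ComputablePred.computable_iff.1 h
    refine ComputablePred.computable_iff.2 ⟨_, hf.comp Computable.encode, funext fun c => ?_⟩
    rw [← congrFun h (Encodable.encode c)]
    simp only [Denumerable.ofNat_encode, eq_iff_iff, Part.dom_iff_mem, evaln_complete]
    rw [exists_comm]
    refine exists_congr fun k => ?_
    cases evaln k c 0 <;> simp

theorem represents_pow (x : ℕ) :
    Represents (update 0 0 x) ![2 ^ x, 0] where
  ne_zero := by simp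
  zero := rfl
  factorization i := by
    have := factorization_nth 0 i
    rw [Nat.nth_prime_zero_eq_two] at this
    simp [this, update_apply]

/-- Search for a zero of a primitive recursive function can be programmed. -/
theorem exists_machine_search {g : ℕ → ℕ → ℕ} (hg : Primrec₂ g) : ∃ T : Machine Unit, ∀ x,
    T.Halts (Sum.inl T.entry, ![2 ^ x, 0]) ↔ ∃ k, g x k = 0 := by
  let s : ℕ → ℕ → ℕ → ℕ := fun x k => update (update 0 0 x) 1 k
  obtain ⟨C, hC⟩ := regComputable_of_primrec' (Nat.Primrec'.prim_iff₂.2 hg) 2 ![0, 1]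
    fun i => by fin_cases i <;> simp
  have hC : ∀ x k, RegRun C (s x k) () (update (s x k) 2 (g x k)) := fun x k => by
    have hs : Fresh 2 (s x k) := fun j hj => by
      simp only [s, update_apply, Pi.zero_apply]; grind
    convert hC _ hs using 3
    · simp [s]
    · simp [s, ← List.Vector.get_zero]
  obtain ⟨D, hD⟩ := exists_reg_dec 2
  obtain ⟨N, hN⟩ := (Programmable.clear (fun _ => True) 2).comp
    (Programmable.inc (fun _ => True) 1) fun _ _ => trivial
  obtain ⟨I, hI⟩ := Programmable.skip fun _ => True
  let B : Machine (Option Unit) := C.bind fun _ => D.bind fun b =>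
    if b then N.mapExit fun _ => none else I.mapExit fun _ => some ()
  have hB0 : ∀ x k, g x k = 0 → RegRun B (s x k) (some ()) (update (s x k) 2 0) := by
    intro x k h
    have h1 := hC x k
    rw [h] at h1
    exact h1.bind (((hD _).1 (by simp)).bind ((hI _ trivial).mapExit _))
  have hB1 : ∀ x k, g x k ≠ 0 → RegRun B (s x k) none (s x (k + 1)) := by
    intro x k h
    have h2 := (hD (update (s x k) 2 (g x k))).2 (by simpa)
    have h3 := (hN _ trivial).mapExit (fun _ => (none : Option Unit)) (r :=
      update (update (s x k) 2 (g x k)) 2 (update (s x k) 2 (g x k) 2 - 1))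
    have h4 : RegRun B (s x k) none _ := (hC x k).bind (h2.bind h3)
    convert h4 using 1
    ext j
    simp only [s, update_apply, Pi.zero_apply]; grind
  have hs : ∀ x, Represents (s x 0) ![2 ^ x, 0] := fun x => by
    convert represents_pow x using 1
    ext j
    simp only [s, update_apply, Pi.zero_apply]; grind
  refine ⟨B.iter, fun x => ⟨fun h => ?_, fun h => ?_⟩⟩
  · by_contra! hx
    refine iter_not_halts (S := fun c => ∃ k, Represents (s x k) c) ?_ ⟨0, hs x⟩ h
    rintro c ⟨k, hc⟩
    obtain ⟨c', hc', hr⟩ := hB1 x k (hx k) c hc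
    exact ⟨c', ⟨k + 1, hc'⟩, hr⟩
  · classical
    have H : ∀ d k, k + d = Nat.find h →
        RegRun B.iter (s x k) () (update (s x (Nat.find h)) 2 0) := by
      intro d
      induction d with
      | zero =>
        rintro k rfl
        exact (hB0 x _ (Nat.find_spec h)).iter_exit
      | succ d ih =>
        intro k hk
        exact (hB1 x k (Nat.find_min h (by omega))).iter_next (ih (k + 1) (by omega))
    obtain ⟨c', -, hr⟩ := H _ 0 (zero_add _) _ (hs x)
    exact .of_run hr

theorem exists_machine_undecidable : ∃ T : Machine Unit,
    ¬ ComputablePred fun x => T.Halts (Sum.inl T.entry, ![2 ^ x, 0]) := by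
  obtain ⟨g, hg, h⟩ := exists_primrec_undecidable
  obtain ⟨T, hT⟩ := exists_machine_search hg
  exact ⟨T, fun h' => h (h'.of_eq hT)⟩

end CounterMachine

namespace InfiniteStateGames

open CounterMachine Function

/-- Undecidability by reduction from the complement of an undecidable set. -/
theorem undecidableOn_of_reduction {α : Type*} [Primcodable α] {valid P : α → Prop}
    {H : ℕ → Prop} (hH : ¬ ComputablePred H) {f : ℕ → α} (hf : Computable f)
    (hv : ∀ x, valid (f x)) (hP : ∀ x, P (f x) ↔ ¬ H x) : UndecidableOn valid P := by
  rintro ⟨g, hg, h⟩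
  have : ComputablePred fun x => ¬ H x :=
    ComputablePred.computable_iff.2 ⟨_, hg.comp hf, funext fun x => by
      rw [← hP x, ← h _ (hv x)]⟩
  exact hH (this.not.of_eq fun x => not_not)

theorem primrec_two_pow : Primrec fun x : ℕ => 2 ^ x :=
  (Primrec.nat_rec₁ 1 (Primrec.nat_mul.comp₂ Primrec₂.right (Primrec₂.const 2))).of_eq fun x => by
    induction x with
    | zero => rfl
    | succ x ih => simp only [ih, pow_succ]

theorem primrec_int_natCast : Primrec fun x : ℕ => (x : ℤ) := by
  refine Primrec.encode_iff.1 ((Primrec.nat_mul.comp (.const 2) .id).of_eq fun x => ?_)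
  rfl

/-! ### Winning one-counter energy games -/

namespace OCEnergyGame

variable {n : ℕ} {G : OCEnergyGame n}

/-- A set of configurations that player 1 can avoid leaving, and in which the energy is never
negative, is won by player 1. -/
theorem player1Wins_of_invariant {S : Config n → Prop} (hneg : ∀ c, S c → ¬ Negative c)
    (h0 : ∀ c, S c → c.1 ∉ G.Q₁ → ∀ c', G.Step c c' → S c')
    (h1 : ∀ c, S c → c.1 ∈ G.Q₁ → ∃ c', G.Step c c' ∧ S c') {c : Config n} (hc : S c) :
    G.Player1Wins c := by
  classical
  let σ : G.Strategy :=
    { next := fun _ c => if h : ∃ c', G.Step c c' ∧ S c' then h.choose else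
        if h : ∃ c', G.Step c c' then h.choose else c
      legal := fun _ c _ h => by
        split_ifs with h'
        · exact h'.choose_spec.1
        · exact h.choose_spec }
  refine ⟨σ, fun π k hπ => hneg _ ?_⟩
  have H : ∀ i ≤ k, S (π i) := by
    intro i
    induction i with
    | zero => exact fun _ => hπ.1 ▸ hc
    | succ i ih =>
      intro hi
      obtain ⟨hs, hn⟩ := hπ.2 i hi
      have hSi := ih (by omega)
      by_cases hQ : (π i).1 ∈ G.Q₁
      · have h := h1 _ hSi hQ
        rw [hn hQ]
        simp only [σ, dif_pos h]
        exact h.choose_spec.2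
      · exact h0 _ hSi hQ _ hs
  exact H k le_rfl

/-- The attractor of negative energy: the configurations from which player 0 can force the energy
to become negative. The constructor `one` applies to both owners; for player 1 it is needed that
all successors are in the attractor. -/
inductive Attractor (G : OCEnergyGame n) : Config n → Prop
  | neg {c : Config n} (h : Negative c) : Attractor G c
  | zero {c c' : Config n} (hQ : c.1 ∉ G.Q₁) (hs : G.Step c c') (h : Attractor G c') :
      Attractor G c
  | one {c : Config n} (hs : ∃ c', G.Step c c') (h : ∀ c', G.Step c c' → Attractor G c') :
      Attractor G c

theorem Strategy.IsPlay.extend {σ : G.Strategy} {c₀ c : Config n} {π : ℕ → Config n} {k : ℕ}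
    (h : σ.IsPlay c₀ π k) (hs : G.Step (π k) c)
    (hn : (π k).1 ∈ G.Q₁ → c = σ.next ((List.range k).map π) (π k)) :
    σ.IsPlay c₀ (fun i => if i ≤ k then π i else c) (k + 1) := by
  refine ⟨by simpa using h.1, fun i hi => ?_⟩
  have hi : i ≤ k := by omega
  have hmap : (List.range i).map (fun i => if i ≤ k then π i else c) = (List.range i).map π :=
    List.map_congr_left fun j hj => if_pos (by have := List.mem_range.1 hj; omega)
  simp only [hmap, if_pos hi]
  rcases hi.lt_or_eq with hi' | rfl
  · rw [if_pos (by omega)]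
    exact h.2 i hi'
  · rw [if_neg (by omega)]
    exact ⟨hs, hn⟩

theorem Attractor.not_player1Wins {c : Config n} (h : G.Attractor c) : ¬ G.Player1Wins c := by
  rintro ⟨σ, hσ⟩
  have H : ∀ c', G.Attractor c' → ∀ π k, σ.IsPlay c π k → π k ≠ c' := by
    intro c' hc'
    induction hc' with
    | neg h =>
      rintro π k hπ rfl
      exact hσ π k hπ h
    | zero hQ hs _ ih =>
      rintro π k hπ rfl
      exact ih _ _ (hπ.extend hs fun h => absurd h hQ) (if_neg (by omega))
    | one hs _ ih =>
      rintro π k hπ rfl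
      by_cases hQ : (π k).1 ∈ G.Q₁
      · have hs' := σ.legal ((List.range k).map π) _ hQ hs
        exact ih _ hs' _ _ (hπ.extend hs' fun _ => rfl) (if_neg (by omega))
      · obtain ⟨c', hs'⟩ := hs
        exact ih _ hs' _ _ (hπ.extend hs' fun h => absurd h hQ) (if_neg (by omega))
  exact H c h (fun _ => c) 0 ⟨rfl, fun i hi => absurd hi (by omega)⟩ rfl

/-! ### Games whose control-states form an arbitrary finite type -/

section ofTyped

variable {S : Type} [Fintype S] (name : S → ℕ) (own : S → Bool)
  (tr : S → List (SignType × S × (Fin n → SignType)))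
  (tr₀ : S → List (Fin 2 × S × (Fin n → SignType)))

/-- The game with control-states `S`, named by natural numbers, of which those with `own s` belong
to player 1, and with the transitions `tr s` and the zero-testing transitions `tr₀ s` from `s`. -/
noncomputable def ofTyped : OCEnergyGame n where
  Q₀ := (Finset.univ.filter fun s => own s = false).toList.map name
  Q₁ := (Finset.univ.filter fun s => own s = true).toList.map name
  δ := Finset.univ.toList.flatMap fun s => (tr s).map fun t => (name s, t.1, name t.2.1, t.2.2)
  δ₀ := Finset.univ.toList.flatMap fun s => (tr₀ s).map fun t => (name s, t.1, name t.2.1, t.2.2)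

variable {name own tr tr₀}

theorem mem_Q₁_ofTyped (hname : Injective name) {s : S} :
    name s ∈ (ofTyped name own tr tr₀).Q₁ ↔ own s = true := by
  simp [ofTyped, hname.eq_iff]

theorem isState_ofTyped (s : S) : (ofTyped name own tr tr₀).IsState (name s) := by
  cases h : own s
  · exact Or.inl (List.mem_map_of_mem (by simpa))
  · exact Or.inr (List.mem_map_of_mem (by simpa))

theorem step_ofTyped (hname : Injective name) {s : S} {m : ℕ} {E : Fin n → ℤ} {c : Config n} :
    (ofTyped name own tr tr₀).Step (name s, m, E) c ↔
      (∃ t ∈ tr s, ∃ m' : ℕ, (m' : ℤ) = m + (t.1 : ℤ) ∧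
        c = (name t.2.1, m', fun i => E i + (t.2.2 i : ℤ))) ∨
      (m = 0 ∧ ∃ t ∈ tr₀ s, c = (name t.2.1, (t.1 : ℕ), fun i => E i + (t.2.2 i : ℤ))) := by
  constructor
  · rintro h
    generalize hx : (name s, m, E) = x at h
    cases h with
    | count mem hm =>
      obtain ⟨s', -, h⟩ := List.mem_flatMap.1 mem
      obtain ⟨t, ht, h⟩ := List.mem_map.1 h
      simp only [Prod.mk.injEq] at h hx
      obtain ⟨rfl, rfl, rfl, rfl⟩ := h
      obtain ⟨hs, rfl, rfl⟩ := hx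
      cases hname hs
      exact Or.inl ⟨t, ht, _, hm, rfl⟩
    | zero mem =>
      obtain ⟨s', -, h⟩ := List.mem_flatMap.1 mem
      obtain ⟨t, ht, h⟩ := List.mem_map.1 h
      simp only [Prod.mk.injEq] at h hx
      obtain ⟨rfl, rfl, rfl, rfl⟩ := h
      obtain ⟨hs, rfl, rfl⟩ := hx
      cases hname hs
      exact Or.inr ⟨rfl, t, ht, rfl⟩
  · rintro (⟨t, ht, m', hm, rfl⟩ | ⟨rfl, t, ht, rfl⟩)
    · exact .count (List.mem_flatMap.2 ⟨s, by simp, List.mem_map_of_mem ht⟩) hm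
    · exact .zero (List.mem_flatMap.2 ⟨s, by simp, List.mem_map_of_mem ht⟩)

theorem wellFormed_ofTyped (hname : Injective name)
    (h : ∀ s (m : ℕ), (∃ t ∈ tr s, 0 ≤ (m : ℤ) + (t.1 : ℤ)) ∨ (m = 0 ∧ ∃ t, t ∈ tr₀ s)) :
    (ofTyped name own tr tr₀).WellFormed where
  disjoint p := by
    rintro ⟨h0, h1⟩
    obtain ⟨s, hs, rfl⟩ := List.mem_map.1 h0
    rw [mem_Q₁_ofTyped hname] at h1
    simp [h1] at hs
  states p d p' C hmem := by
    obtain ⟨s, -, hs⟩ := List.mem_flatMap.1 hmem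
    obtain ⟨t, -, ht⟩ := List.mem_map.1 hs
    cases ht
    exact ⟨isState_ofTyped _, isState_ofTyped _⟩
  states₀ p d p' C hmem := by
    obtain ⟨s, -, hs⟩ := List.mem_flatMap.1 hmem
    obtain ⟨t, -, ht⟩ := List.mem_map.1 hs
    cases ht
    exact ⟨isState_ofTyped _, isState_ofTyped _⟩
  nonblocking p m E hp := by
    obtain ⟨s, rfl⟩ : ∃ s, name s = p := by
      rcases hp with hp | hp <;> obtain ⟨s, -, hs⟩ := List.mem_map.1 hp <;> exact ⟨s, hs⟩
    rcases h s m with ⟨t, ht, hm⟩ | ⟨hm, t, ht⟩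
    · exact ⟨_, (step_ofTyped hname).2 (Or.inl ⟨t, ht, _, Int.toNat_of_nonneg hm, rfl⟩)⟩
    · exact ⟨_, (step_ofTyped hname).2 (Or.inr ⟨hm, t, ht, rfl⟩)⟩

end ofTyped

end OCEnergyGame

end InfiniteStateGames

namespace InfiniteStateGames

open CounterMachine CounterMachine.Machine Function

namespace OCEnergyGame

/-! ### The energy game of a two-counter machine -/

/-- Control-states of the energy game of a machine with control-states `σ`. -/
inductive Position (σ : Type) : Type
  /-- the machine is at the control-state or exit `t` -/
  | run (t : σ ⊕ Unit)
  /-- player 1 has claimed that counter `b` is zero, so that the machine continues at `z` -/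
  | check (b : Fin 2) (z : σ ⊕ Unit)
  /-- player 0 compares the counter of the game with the energy component `b` -/
  | drain (b : Fin 2)
  /-- the comparison has been completed, to the advantage of player 1 -/
  | sink
  deriving Fintype

section

variable {n : ℕ}

/-- The change of the energy that increments the component of counter `b`. -/
def unit (n : ℕ) (b : Fin 2) : Fin n → SignType := fun i => if i.1 = b.1 then 1 else 0

/-- The energy that consists of the values of the counters, followed by zeros. -/
def energy (n : ℕ) (c : Fin 2 → ℕ) : Fin n → ℤ := fun i => if h : i.1 < 2 then c ⟨i.1, h⟩ else 0

theorem energy_inc (c : Fin 2 → ℕ) (b : Fin 2) :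
    (fun i => energy n c i + (unit n b i : ℤ)) = energy n (update c b (c b + 1)) := by
  ext i
  simp only [energy, unit, update_apply, Fin.ext_iff]
  by_cases h : i.1 = b.1
  · have hb : (⟨i.1, h ▸ b.2⟩ : Fin 2) = b := Fin.ext h
    have : b.1 ≤ 1 := by omega
    simp [h, this]
  · by_cases h2 : i.1 < 2 <;> simp [h, h2]

theorem energy_dec {c : Fin 2 → ℕ} {b : Fin 2} (hc : c b ≠ 0) :
    (fun i => energy n c i + ((-unit n b i : SignType) : ℤ)) =
      energy n (update c b (c b - 1)) := by
  ext i
  simp only [energy, unit, update_apply, Fin.ext_iff]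
  by_cases h : i.1 = b.1
  · have : i.1 < 2 := h ▸ b.2
    simp [h]; omega
  · by_cases h2 : i.1 < 2 <;> simp [h, h2]

theorem sum_inc (c : Fin 2 → ℕ) (b : Fin 2) :
    update c b (c b + 1) 0 + update c b (c b + 1) 1 = c 0 + c 1 + 1 := by
  fin_cases b <;> simp <;> omega

theorem sum_dec {c : Fin 2 → ℕ} {b : Fin 2} (hc : c b ≠ 0) :
    update c b (c b - 1) 0 + update c b (c b - 1) 1 + 1 = c 0 + c 1 := by
  fin_cases b <;> simp at hc ⊢ <;> omega

theorem sum_of_eq_zero {c : Fin 2 → ℕ} {b : Fin 2} (hc : c b = 0) : c 0 + c 1 = c (1 - b) := by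
  fin_cases b <;> simp at hc ⊢ <;> omega

theorem energy_zero (c : Fin 2 → ℕ) :
    (fun i => energy n c i + (((0 : Fin n → SignType) i : SignType) : ℤ)) = energy n c := by
  ext i; simp

theorem not_negative_energy {p m : ℕ} (c : Fin 2 → ℕ) : ¬ Negative (p, m, energy n c) := by
  rintro ⟨i, hi⟩
  simp only [energy] at hi
  split_ifs at hi <;> omega

end

section machine

variable (n : ℕ) (T : Machine Unit)

/-- Player 1 chooses how the machine continues, and only where it may decrement a counter; all
other choices belong to player 0. -/
def owner : Position T.σ → Bool
  | .run _ => true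
  | _ => false

/-- The counter of the game is the sum of the counters of the machine, which are the first two
components of the energy. Player 1 may claim that a counter `b` is zero, which player 0 may
contest: then the other counter is compared with the sum of both. -/
def trans : Position T.σ → List (SignType × Position T.σ × (Fin n → SignType))
  | .run (.inl s) => match T.code s with
    | .inc b t => [(1, .run t, unit n b)]
    | .dec b t z => [(-1, .run t, -unit n b), (0, .check b z, 0)]
  | .run (.inr _) => [(0, .run (.inr ()), -unit n 0)]
  | .check b z => [(0, .run z, 0), (0, .drain (1 - b), 0)]
  | .drain b => [(-1, .drain b, -unit n b)]
  | .sink => [(0, .sink, 0)]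

/-- The comparison ends when the counter of the game is zero. -/
def transZero : Position T.σ → List (Fin 2 × Position T.σ × (Fin n → SignType))
  | .drain _ => [(0, .sink, 0)]
  | _ => []

variable [Fintype T.σ] (name : Position T.σ → ℕ)

/-- The energy game in which player 1 simulates the machine `T`. -/
noncomputable def ofMachine : OCEnergyGame n := ofTyped name (owner T) (trans n T) (transZero n T)

variable {n T name}

theorem wellFormed_ofMachine (hname : Injective name) : (ofMachine n T name).WellFormed := by
  refine wellFormed_ofTyped hname fun s m => ?_
  match s with
  | .run (.inl s) =>
    refine .inl ?_
    simp only [trans]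
    cases T.code s with
    | inc b t => exact ⟨_, List.mem_singleton_self _, by simp; omega⟩
    | dec b t z => exact ⟨(0, .check b z, 0), by simp, by simp⟩
  | .run (.inr _) => exact .inl ⟨_, List.mem_singleton_self _, by simp⟩
  | .check b z => exact .inl ⟨(0, .run z, 0), by simp [trans], by simp⟩
  | .drain b =>
    rcases Nat.eq_zero_or_pos m with rfl | hm
    · exact .inr ⟨rfl, _, List.mem_singleton_self _⟩
    · exact .inl ⟨_, List.mem_singleton_self _, by simp; omega⟩
  | .sink => exact .inl ⟨_, List.mem_singleton_self _, by simp⟩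

/-- The configurations won by player 1 if the computation simulated so far does not halt. -/
inductive Invariant (n : ℕ) (T : Machine Unit) (name : Position T.σ → ℕ) : Config n → Prop
  | run {t : T.σ ⊕ Unit} {c : Fin 2 → ℕ} (h : ¬ T.Halts (t, c)) :
      Invariant n T name (name (.run t), c 0 + c 1, energy n c)
  | check {b : Fin 2} {z : T.σ ⊕ Unit} {c : Fin 2 → ℕ} (hc : c b = 0) (h : ¬ T.Halts (z, c)) :
      Invariant n T name (name (.check b z), c 0 + c 1, energy n c)
  | drain {b : Fin 2} {c : Fin 2 → ℕ} :
      Invariant n T name (name (.drain b), c b, energy n c)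
  | sink {m : ℕ} {c : Fin 2 → ℕ} : Invariant n T name (name .sink, m, energy n c)

theorem player1Wins_of_not_halts (hname : Injective name) {t : T.σ ⊕ Unit} {c : Fin 2 → ℕ} (h : ¬ T.Halts (t, c)) :
    (ofMachine n T name).Player1Wins (name (.run t), c 0 + c 1, energy n c) := by
  refine player1Wins_of_invariant (S := Invariant n T name) ?_ ?_ ?_ (.run h)
  · rintro _ (_ | _ | _ | _) <;> exact not_negative_energy _
  · rintro _ (h | ⟨hc, h⟩ | _ | _) hQ c' hs
    · exact absurd ((mem_Q₁_ofTyped hname).2 rfl) hQ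
    · simp only [ofMachine, step_ofTyped hname, trans, transZero, List.mem_cons,
        List.not_mem_nil, or_false, false_and, exists_false, and_false, exists_eq_or_imp,
        exists_eq_left, energy_zero] at hs
      simp only [SignType.coe_zero, add_zero, Nat.cast_inj, exists_eq_left] at hs
      rcases hs with rfl | rfl
      · exact .run h
      · rw [sum_of_eq_zero hc]
        exact .drain
    · simp only [ofMachine, step_ofTyped hname, trans, transZero, List.mem_cons,
        List.not_mem_nil, or_false, exists_eq_left, energy_zero] at hs
      rcases hs with ⟨m', hm, rfl⟩ | ⟨_, rfl⟩
      · rename_i b c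
        have hm' : m' + 1 = c b := by simp at hm; omega
        have hc : c b ≠ 0 := by omega
        simp only [Pi.neg_apply]
        rw [energy_dec hc]
        obtain rfl : m' = c b - 1 := by omega
        have := Invariant.drain (n := n) (name := name) (b := b) (c := update c b (c b - 1))
        rwa [update_self] at this
      · exact .sink
    · simp only [ofMachine, step_ofTyped hname, trans, transZero, List.mem_cons,
        List.not_mem_nil, or_false, false_and, exists_false, and_false,
        exists_eq_left, energy_zero] at hs
      obtain ⟨m', hm, rfl⟩ := hs
      exact .sink
  · rintro _ (⟨h⟩ | ⟨hc, h⟩ | _ | _) hQ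
    · rename_i t c
      match t, h with
      | .inr _, h => exact absurd (.exit _ _) h
      | .inl s, h =>
        rw [halts_iff_exec] at h
        simp only [ofMachine, step_ofTyped hname, trans]
        cases hI : T.code s with
        | inc b t =>
          rw [hI] at h
          refine ⟨_, .inl ⟨_, List.mem_singleton_self _, c 0 + c 1 + 1, by simp, rfl⟩, ?_⟩
          rw [energy_inc, ← sum_inc c b]
          exact .run h
        | dec b t z =>
          rw [hI] at h
          by_cases hc : c b = 0
          · refine ⟨_, .inl ⟨(0, .check b z, 0), by simp, c 0 + c 1, by simp, rfl⟩, ?_⟩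
            rw [energy_zero]
            exact .check hc (by simpa [Instr.exec, hc] using h)
          · have := sum_dec hc
            refine ⟨_, .inl ⟨(-1, .run t, -unit n b), by simp, c 0 + c 1 - 1, ?_, rfl⟩, ?_⟩
            · simp; omega
            · simp only [Pi.neg_apply]
              rw [energy_dec hc, ← this]
              exact .run (by simpa [Instr.exec, hc] using h)
    all_goals simp [ofMachine, mem_Q₁_ofTyped hname, owner] at hQ

/-- The comparison of the counter of the game with a smaller component of the energy. -/
theorem attractor_drain (hname : Injective name) (b : Fin 2) (hb : b.1 < n) (m : ℕ)
    (E : Fin n → ℤ) (h : E ⟨b, hb⟩ < m) :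
    (ofMachine n T name).Attractor (name (.drain b), m, E) := by
  induction m generalizing E with
  | zero => exact .neg ⟨_, by simpa using h⟩
  | succ m ih =>
    refine .zero (by simp [ofMachine, mem_Q₁_ofTyped hname, owner])
      ((step_ofTyped hname).2 (.inl ⟨_, List.mem_singleton_self _, m, by simp, rfl⟩)) (ih _ ?_)
    push_cast at h
    simp [unit]
    omega

/-- At the exit of the machine the first component of the energy decreases forever. -/
theorem attractor_exit (hname : Injective name) (hn : 0 < n) (m : ℕ) (E : Fin n → ℤ) :
    (ofMachine n T name).Attractor (name (.run (.inr ())), m, E) := by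
  obtain ⟨k, hk⟩ : ∃ k : ℕ, E ⟨0, hn⟩ < k := ⟨(E ⟨0, hn⟩ + 1).toNat, by omega⟩
  induction k generalizing m E with
  | zero => exact .neg ⟨_, by simpa using hk⟩
  | succ k ih =>
    refine .one ⟨_, (step_ofTyped hname).2 (.inl ⟨_, List.mem_singleton_self _, m, by simp, rfl⟩)⟩
      fun c' hs => ?_
    simp only [ofMachine, step_ofTyped hname, trans, transZero, List.mem_cons,
      List.not_mem_nil, or_false, false_and, exists_false, and_false, exists_eq_left] at hs
    obtain ⟨m', -, rfl⟩ := hs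
    refine ih _ _ ?_
    push_cast at hk
    simp [unit]
    omega

theorem attractor_of_halts (hname : Injective name) (hn : 2 ≤ n) {x : T.Cfg} (h : T.Halts x) :
    (ofMachine n T name).Attractor (name (.run x.1), x.2 0 + x.2 1, energy n x.2) := by
  induction h with
  | exit e c => exact attractor_exit hname (by omega) _ _
  | step s c _ ih =>
    have hne := (wellFormed_ofMachine (n := n) hname).nonblocking (name (.run (.inl s)))
      (c 0 + c 1) (energy n c) (isState_ofTyped _)
    refine .one hne fun c' hs => ?_
    simp only [ofMachine, step_ofTyped hname, trans, transZero,
      List.not_mem_nil, false_and, exists_false, and_false, or_false] at hs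
    cases hI : T.code s with
    | inc b t =>
      simp only [hI, List.mem_cons, List.not_mem_nil, or_false, exists_eq_left, energy_inc] at hs
      obtain ⟨m', hm, rfl⟩ := hs
      rw [hI] at ih
      obtain rfl : m' = update c b (c b + 1) 0 + update c b (c b + 1) 1 := by
        rw [sum_inc]; simp at hm; omega
      exact ih
    | dec b t z =>
      simp only [hI, List.mem_cons, List.not_mem_nil, or_false, exists_eq_or_imp,
        exists_eq_left, energy_zero] at hs
      rw [hI] at ih
      by_cases hc : c b = 0
      · simp only [Instr.exec, hc, if_true] at ih
        rcases hs with ⟨m', hm, rfl⟩ | ⟨m', hm, rfl⟩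
        -- Player 1 has decremented a component of the energy that is zero.
        · refine .neg ⟨⟨b, by omega⟩, ?_⟩
          simp [energy, unit, hc]
        · obtain rfl : m' = c 0 + c 1 := by simp at hm; omega
          refine .zero (by simp [ofMachine, mem_Q₁_ofTyped hname, owner])
            ((step_ofTyped hname).2 (.inl ⟨(0, .run z, 0), by simp [trans],
              c 0 + c 1, by simp, rfl⟩)) ?_
          rwa [energy_zero]
      · simp only [Instr.exec, hc, if_false] at ih
        have hsum := sum_dec hc
        rcases hs with ⟨m', hm, rfl⟩ | ⟨m', hm, rfl⟩
        · obtain rfl : m' = update c b (c b - 1) 0 + update c b (c b - 1) 1 := by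
            simp at hm; omega
          simp only [Pi.neg_apply]
          rwa [energy_dec hc]
        -- Player 1 has made a false claim, which player 0 contests.
        · obtain rfl : m' = c 0 + c 1 := by simp at hm; omega
          refine .zero (by simp [ofMachine, mem_Q₁_ofTyped hname, owner])
            ((step_ofTyped hname).2
              (.inl ⟨(0, .drain (1 - b), 0), by simp [trans], c 0 + c 1, by simp, rfl⟩)) ?_
          refine attractor_drain hname _ (by omega) _ _ ?_
          fin_cases b <;> simp [energy] at hc ⊢ <;> omega

end machine

theorem computable_energy (n : ℕ) : Computable fun x : ℕ => energy n ![2 ^ x, 0] := by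
  refine ((Primrec.fin_curry (f := fun x => energy n ![2 ^ x, 0])).2 ((Primrec.fin_curry₁
    (f := fun i x => energy n ![2 ^ x, 0] i)).2 fun i => ?_).swap).to_comp
  by_cases h : i.1 = 0
  · refine (primrec_int_natCast.comp primrec_two_pow).of_eq fun x => ?_
    simp [energy, h]
  · refine (Primrec.const (0 : ℤ)).of_eq fun x => ?_
    simp only [energy]
    split_ifs with h2
    · have : (⟨i.1, h2⟩ : Fin 2) = 1 := Fin.ext (by simp; omega)
      simp [this]
    · rfl

end OCEnergyGame

theorem fixedInitialCredit_undecidable {n : ℕ} (hn : 2 ≤ n) :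
    UndecidableOn (ValidCreditInput (n := n)) (FixedInitialCredit (n := n)) := by
  open OCEnergyGame in
  obtain ⟨T, hT⟩ := exists_machine_undecidable
  have := T.fin
  have := Fintype.ofFinite T.σ
  obtain ⟨name, hname⟩ := Countable.exists_injective_nat (Position T.σ)
  refine undecidableOn_of_reduction hT (f := fun x => (ofMachine n T name,
    (name (.run (.inl T.entry)), 2 ^ x, energy n ![2 ^ x, 0]))) ?_
    (fun x => ⟨wellFormed_ofMachine hname, isState_ofTyped _⟩) fun x => ⟨fun h hH => ?_, fun h => ?_⟩
  · exact (Computable.const _).pair ((Computable.const _).pair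
      (primrec_two_pow.to_comp.pair (computable_energy n)))
  · exact (attractor_of_halts hname hn hH).not_player1Wins
      (by simpa [FixedInitialCredit] using h)
  · simpa [FixedInitialCredit] using player1Wins_of_not_halts (n := n) hname h

end InfiniteStateGames

namespace InfiniteStateGames

open CounterMachine CounterMachine.Machine Function

/-! ### Automata whose control-states form an arbitrary finite type -/

namespace OCA

variable {S : Type} [Fintype S] {k : ℕ} (name : S → ℕ) (tr : S → List (Fin k × SignType × S))

/-- The one-counter automaton with control-states `S`, named by natural numbers, action labels
`0, …, k - 1`, the transitions `tr s` from `s`, and no zero tests. -/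
noncomputable def ofTyped : OCA where
  Q := Finset.univ.toList.map name
  Act := List.range k
  δ := Finset.univ.toList.flatMap fun s =>
    (tr s).map fun t => (name s, (t.1 : ℕ), t.2.1, name t.2.2)
  δ₀ := []

variable {name tr}

theorem mem_Q_ofTyped (s : S) : name s ∈ (ofTyped name tr).Q :=
  List.mem_map_of_mem (by simp)

theorem wellFormed_ofTyped : (ofTyped name tr).WellFormed where
  trans p a d p' hmem := by
    obtain ⟨s, -, hs⟩ := List.mem_flatMap.1 hmem
    obtain ⟨t, -, ht⟩ := List.mem_map.1 hs
    cases ht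
    exact ⟨mem_Q_ofTyped _, by simp [ofTyped], mem_Q_ofTyped _⟩
  trans₀ p a d p' hmem := by simp [ofTyped] at hmem

theorem step_ofTyped (hname : Injective name) {s : S} {m a : ℕ} {x : ℕ × ℕ} :
    (ofTyped name tr).Step (name s, m) a x ↔
      ∃ t ∈ tr s, a = t.1 ∧ ∃ m' : ℕ, (m' : ℤ) = m + (t.2.1 : ℤ) ∧ x = (name t.2.2, m') := by
  constructor
  · intro h
    generalize hy : (name s, m) = y at h
    cases h with
    | count mem hm =>
      obtain ⟨s', -, h⟩ := List.mem_flatMap.1 mem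
      obtain ⟨t, ht, h⟩ := List.mem_map.1 h
      simp only [Prod.mk.injEq] at h hy
      obtain ⟨rfl, rfl, rfl, rfl⟩ := h
      obtain ⟨hs, rfl⟩ := hy
      cases hname hs
      exact ⟨t, ht, rfl, _, hm, rfl⟩
    | zero mem => simp [ofTyped] at mem
  · rintro ⟨t, ht, rfl, m', hm, rfl⟩
    exact .count (List.mem_flatMap.2 ⟨s, by simp, List.mem_map_of_mem ht⟩) hm

end OCA

namespace VASS

variable {n : ℕ} {S : Type} [Fintype S] {k : ℕ} (name : S → ℕ)
  (tr : S → List (Fin k × S × (Fin n → SignType)))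

/-- The vector addition system with control-states `S`, named by natural numbers, action labels
`0, …, k - 1`, and the transitions `tr s` from `s`. -/
noncomputable def ofTyped : VASS n where
  Q := Finset.univ.toList.map name
  Act := List.range k
  δ := Finset.univ.toList.flatMap fun s =>
    (tr s).map fun t => (name s, (t.1 : ℕ), name t.2.1, t.2.2)

variable {name tr}

theorem mem_Q_ofTyped (s : S) : name s ∈ (ofTyped name tr).Q :=
  List.mem_map_of_mem (by simp)

theorem wellFormed_ofTyped : (ofTyped name tr).WellFormed where
  trans p a p' D hmem := by
    obtain ⟨s, -, hs⟩ := List.mem_flatMap.1 hmem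
    obtain ⟨t, -, ht⟩ := List.mem_map.1 hs
    cases ht
    exact ⟨mem_Q_ofTyped _, by simp [ofTyped], mem_Q_ofTyped _⟩

theorem step_ofTyped (hname : Injective name) {s : S} {C : Fin n → ℕ} {a : ℕ}
    {x : ℕ × (Fin n → ℕ)} :
    (ofTyped name tr).Step (name s, C) a x ↔
      ∃ t ∈ tr s, a = t.1 ∧ ∃ C' : Fin n → ℕ, (∀ i, (C' i : ℤ) = C i + (t.2.2 i : ℤ)) ∧
        x = (name t.2.1, C') := by
  constructor
  · intro h
    generalize hy : (name s, C) = y at h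
    cases h with
    | move mem hC =>
      obtain ⟨s', -, h⟩ := List.mem_flatMap.1 mem
      obtain ⟨t, ht, h⟩ := List.mem_map.1 h
      simp only [Prod.mk.injEq] at h hy
      obtain ⟨rfl, rfl, rfl, rfl⟩ := h
      obtain ⟨hs, rfl⟩ := hy
      cases hname hs
      exact ⟨t, ht, rfl, _, hC, rfl⟩
  · rintro ⟨t, ht, rfl, C', hC, rfl⟩
    exact .move (List.mem_flatMap.2 ⟨s, by simp, List.mem_map_of_mem ht⟩) hC

end VASS

/-! ### The simulation game of a two-counter machine -/

namespace MachineSimulation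

/-- Control-states of the one-counter automaton of a machine with control-states `σ`. -/
inductive Spoiler (σ : Type) : Type
  /-- the machine is at the control-state or exit `t` -/
  | run (t : σ ⊕ Unit)
  /-- the machine decrements a counter and continues at `t`, or at `z` if the counter is zero,
  which the vector addition system has decided -/
  | wait (t z : σ ⊕ Unit)
  /-- the counter is compared with one of the counters of the vector addition system -/
  | drain
  deriving Fintype

/-- Control-states of the vector addition system of a machine with control-states `σ`. -/
inductive Duplicator (σ : Type) : Type
  /-- the machine is at the control-state or exit `t` -/
  | run (t : σ ⊕ Unit)
  /-- a counter has been decremented, so that the machine continues at `t` -/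
  | dec (t : σ ⊕ Unit)
  /-- counter `b` has been claimed to be zero, so that the machine continues at `z` -/
  | zero (b : Fin 2) (z : σ ⊕ Unit)
  /-- counter `b` is compared with the counter of the automaton -/
  | drain (b : Fin 2)
  /-- every action is possible forever -/
  | any
  deriving Fintype

open OCEnergyGame (unit sum_inc sum_dec sum_of_eq_zero)

theorem unit_inc_iff {c c' : Fin 2 → ℕ} {b : Fin 2} :
    (∀ i, (c' i : ℤ) = c i + (unit 2 b i : ℤ)) ↔ c' = update c b (c b + 1) := by
  rw [funext_iff]
  refine forall_congr' fun i => ?_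
  by_cases h : i = b
  · subst h; simp [unit]; omega
  · simp [unit, h, Fin.val_ne_of_ne h]

theorem unit_dec_iff {c c' : Fin 2 → ℕ} {b : Fin 2} :
    (∀ i, (c' i : ℤ) = c i + (((-unit 2 b) i : SignType) : ℤ)) ↔
      c b ≠ 0 ∧ c' = update c b (c b - 1) := by
  constructor
  · intro h
    have hb := h b
    simp [unit] at hb
    refine ⟨by omega, funext fun i => ?_⟩
    have hi := h i
    by_cases h : i = b
    · subst h; simp; omega
    · simp [unit, h, Fin.val_ne_of_ne h] at hi ⊢
      exact hi
  · rintro ⟨h, rfl⟩ i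
    by_cases hi : i = b
    · subst hi; simp [unit]; omega
    · simp [unit, hi, Fin.val_ne_of_ne hi]

theorem unit_zero_iff {c c' : Fin 2 → ℕ} :
    (∀ i, (c' i : ℤ) = c i + (((0 : Fin 2 → SignType) i : SignType) : ℤ)) ↔ c' = c := by
  simp [funext_iff]

variable (T : Machine Unit)

/-- The automaton keeps the sum of the counters of the machine. It decides whether to contest
a claim that a counter is zero, with action `3`; otherwise it confirms with action `1` that the
counter is zero, or with action `2` that it has been decremented. All other steps have
action `0`. -/
def ocaTrans : Spoiler T.σ → List (Fin 4 × SignType × Spoiler T.σ)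
  | .run (.inl s) => match T.code s with
    | .inc _ t => [(0, 1, .run t)]
    | .dec _ t z => [(0, 0, .wait t z)]
  | .run (.inr _) => [(0, 0, .run (.inr ()))]
  | .wait t z => [(1, 0, .run z), (2, -1, .run t), (3, 0, .drain)]
  | .drain => [(0, -1, .drain)]

/-- The vector addition system keeps the counters of the machine. It chooses between decrementing
a counter and claiming that it is zero; if the automaton does not confirm its choice, every action
becomes possible. When a claim about counter `b` is contested, the other counter is compared with
the sum of both. -/
def vassTrans : Duplicator T.σ → List (Fin 4 × Duplicator T.σ × (Fin 2 → SignType))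
  | .run (.inl s) => match T.code s with
    | .inc b t => [(0, .run t, unit 2 b)]
    | .dec b t z => [(0, .dec t, -unit 2 b), (0, .zero b z, 0)]
  | .run (.inr _) => []
  | .dec t => [(1, .any, 0), (2, .run t, 0), (3, .any, 0)]
  | .zero b z => [(1, .run z, 0), (2, .any, 0), (3, .drain (1 - b), 0)]
  | .drain b => [(0, .drain b, -unit 2 b)]
  | .any => [(0, .any, 0), (1, .any, 0), (2, .any, 0), (3, .any, 0)]

variable [Fintype T.σ] (name : Spoiler T.σ → ℕ) (name' : Duplicator T.σ → ℕ)

/-- The pairs in the simulation relation if the computation simulated so far does not halt. -/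
inductive Rel : ℕ × ℕ → ℕ × (Fin 2 → ℕ) → Prop
  | run {t : T.σ ⊕ Unit} {c : Fin 2 → ℕ} (h : ¬ T.Halts (t, c)) :
      Rel (name (.run t), c 0 + c 1) (name' (.run t), c)
  | dec {t z : T.σ ⊕ Unit} {c : Fin 2 → ℕ} (h : ¬ T.Halts (t, c)) :
      Rel (name (.wait t z), c 0 + c 1 + 1) (name' (.dec t), c)
  | zero {b : Fin 2} {t z : T.σ ⊕ Unit} {c : Fin 2 → ℕ} (hc : c b = 0) (h : ¬ T.Halts (z, c)) :
      Rel (name (.wait t z), c 0 + c 1) (name' (.zero b z), c)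
  | drain {b : Fin 2} {c : Fin 2 → ℕ} : Rel (name .drain, c b) (name' (.drain b), c)
  | any {s : Spoiler T.σ} {m : ℕ} {c : Fin 2 → ℕ} : Rel (name s, m) (name' .any, c)

variable {T name name'}

theorem isSimulation_rel (hname : Injective name) (hname' : Injective name') :
    IsSimulation (OCA.ofTyped name (ocaTrans T)).Step (VASS.ofTyped name' (vassTrans T)).Step
      (Rel T name name') := by
  have vstep : ∀ {s : Duplicator T.σ} {c c' : Fin 2 → ℕ} (t), t ∈ vassTrans T s →
      (∀ i, (c' i : ℤ) = c i + (t.2.2 i : ℤ)) →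
      (VASS.ofTyped name' (vassTrans T)).Step (name' s, c) t.1 (name' t.2.1, c') :=
    fun t ht hc => (VASS.step_ofTyped hname').2 ⟨t, ht, rfl, _, hc, rfl⟩
  rintro _ _ (⟨h⟩ | ⟨h⟩ | ⟨hc, h⟩ | _ | _) a x hs
  · rename_i t c
    match t, h with
    | .inr _, h => exact absurd (.exit _ _) h
    | .inl s, h =>
      rw [halts_iff_exec] at h
      rw [OCA.step_ofTyped hname] at hs
      simp only [ocaTrans] at hs
      cases hI : T.code s with
      | inc b t =>
        rw [hI] at h
        simp only [hI, List.mem_singleton, exists_eq_left] at hs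
        obtain ⟨rfl, m', hm, rfl⟩ := hs
        refine ⟨_, vstep (0, .run t, unit 2 b) (by simp [vassTrans, hI]) (unit_inc_iff.2 rfl), ?_⟩
        obtain rfl : m' = c 0 + c 1 + 1 := by simp at hm; omega
        rw [← sum_inc c b]
        exact .run h
      | dec b t z =>
        rw [hI] at h
        simp only [hI, List.mem_singleton, exists_eq_left] at hs
        obtain ⟨rfl, m', hm, rfl⟩ := hs
        obtain rfl : m' = c 0 + c 1 := by simp at hm; omega
        by_cases hc : c b = 0
        · exact ⟨_, vstep (0, .zero b z, 0) (by simp [vassTrans, hI]) (unit_zero_iff.2 rfl),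
            .zero hc (by simpa [Instr.exec, hc] using h)⟩
        · refine ⟨_, vstep (0, .dec t, -unit 2 b) (by simp [vassTrans, hI])
            (unit_dec_iff.2 ⟨hc, rfl⟩), ?_⟩
          rw [← sum_dec hc]
          exact .dec (by simpa [Instr.exec, hc] using h)
  · rename_i t z c
    simp only [OCA.step_ofTyped hname, ocaTrans, List.mem_cons, List.not_mem_nil, or_false,
      exists_eq_or_imp, exists_eq_left] at hs
    rcases hs with ⟨rfl, m', hm, rfl⟩ | ⟨rfl, m', hm, rfl⟩ | ⟨rfl, m', hm, rfl⟩
    · exact ⟨_, vstep (1, .any, 0) (by simp [vassTrans]) (unit_zero_iff.2 rfl), .any⟩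
    · obtain rfl : m' = c 0 + c 1 := by simp at hm; omega
      exact ⟨_, vstep (2, .run t, 0) (by simp [vassTrans]) (unit_zero_iff.2 rfl), .run h⟩
    · exact ⟨_, vstep (3, .any, 0) (by simp [vassTrans]) (unit_zero_iff.2 rfl), .any⟩
  · rename_i b t z c
    simp only [OCA.step_ofTyped hname, ocaTrans, List.mem_cons, List.not_mem_nil, or_false,
      exists_eq_or_imp, exists_eq_left] at hs
    rcases hs with ⟨rfl, m', hm, rfl⟩ | ⟨rfl, m', hm, rfl⟩ | ⟨rfl, m', hm, rfl⟩
    · obtain rfl : m' = c 0 + c 1 := by simp at hm; omega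
      exact ⟨_, vstep (1, .run z, 0) (by simp [vassTrans]) (unit_zero_iff.2 rfl), .run h⟩
    · exact ⟨_, vstep (2, .any, 0) (by simp [vassTrans]) (unit_zero_iff.2 rfl), .any⟩
    · refine ⟨_, vstep (3, .drain (1 - b), 0) (by simp [vassTrans]) (unit_zero_iff.2 rfl), ?_⟩
      obtain rfl : m' = c (1 - b) := by rw [← sum_of_eq_zero hc]; simp at hm; omega
      exact .drain
  · rename_i b c
    simp only [OCA.step_ofTyped hname, ocaTrans, List.mem_singleton, exists_eq_left] at hs
    obtain ⟨rfl, m', hm, rfl⟩ := hs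
    have hm' : m' + 1 = c b := by simp at hm; omega
    refine ⟨_, vstep (0, .drain b, -unit 2 b) (by simp [vassTrans])
      (unit_dec_iff.2 ⟨by omega, rfl⟩), ?_⟩
    obtain rfl : m' = c b - 1 := by omega
    have := Rel.drain (T := T) (name := name) (name' := name') (b := b)
      (c := update c b (c b - 1))
    rwa [update_self] at this
  · rename_i s m c
    obtain ⟨t, -, rfl, m', -, rfl⟩ := (OCA.step_ofTyped hname).1 hs
    refine ⟨(name' .any, c), vstep (t.1, .any, 0) ?_ (unit_zero_iff.2 rfl), .any⟩
    generalize t.1 = a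
    fin_cases a <;> simp [vassTrans]

section not_simulates

variable {R : ℕ × ℕ → ℕ × (Fin 2 → ℕ) → Prop}

/-- The comparison of the counter of the automaton with a smaller counter of the vector addition
system. -/
theorem not_rel_drain (hname : Injective name) (hname' : Injective name')
    (hR : IsSimulation (OCA.ofTyped name (ocaTrans T)).Step
      (VASS.ofTyped name' (vassTrans T)).Step R) (b : Fin 2) (m : ℕ) (c : Fin 2 → ℕ)
    (h : c b < m) : ¬ R (name .drain, m) (name' (.drain b), c) := by
  induction m generalizing c with
  | zero => omega
  | succ m ih =>
    intro hr
    obtain ⟨y, hy, hr'⟩ := hR _ _ hr 0 (name .drain, m) ((OCA.step_ofTyped hname).2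
      ⟨(0, -1, .drain), by simp [ocaTrans], rfl, m, by simp, rfl⟩)
    simp only [VASS.step_ofTyped hname', vassTrans, List.mem_singleton, exists_eq_left,
      unit_dec_iff] at hy
    obtain ⟨-, c', ⟨hc, rfl⟩, rfl⟩ := hy
    exact ih _ (by rw [update_self]; omega) hr'

theorem not_rel_of_halts (hname : Injective name) (hname' : Injective name')
    (hR : IsSimulation (OCA.ofTyped name (ocaTrans T)).Step
      (VASS.ofTyped name' (vassTrans T)).Step R) {x : T.Cfg} (h : T.Halts x) :
    ¬ R (name (.run x.1), x.2 0 + x.2 1) (name' (.run x.1), x.2) := by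
  have ostep : ∀ {s : Spoiler T.σ} {m m' : ℕ} (t), t ∈ ocaTrans T s →
      (m' : ℤ) = m + (t.2.1 : ℤ) →
      (OCA.ofTyped name (ocaTrans T)).Step (name s, m) t.1 (name t.2.2, m') :=
    fun t ht hm => (OCA.step_ofTyped hname).2 ⟨t, ht, rfl, _, hm, rfl⟩
  induction h with
  | exit e c =>
    intro hr
    obtain ⟨y, hy, -⟩ := hR _ _ hr _ _ (ostep (m' := c 0 + c 1) (0, 0, .run (.inr ()))
      (by simp [ocaTrans]) (by simp))
    simp [VASS.step_ofTyped hname', vassTrans] at hy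
  | step s c _ ih =>
    intro hr
    cases hI : T.code s with
    | inc b t =>
      rw [hI] at ih
      obtain ⟨y, hy, hr'⟩ := hR _ _ hr _ _ (ostep (m' := c 0 + c 1 + 1) (0, 1, .run t)
        (by simp [ocaTrans, hI]) (by simp))
      simp only [VASS.step_ofTyped hname', vassTrans, hI, List.mem_singleton, exists_eq_left,
        unit_inc_iff] at hy
      obtain ⟨-, c', rfl, rfl⟩ := hy
      rw [← sum_inc c b] at hr'
      exact ih hr'
    | dec b t z =>
      rw [hI] at ih
      obtain ⟨y, hy, hr'⟩ := hR _ _ hr _ _ (ostep (m' := c 0 + c 1) (0, 0, .wait t z)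
        (by simp [ocaTrans, hI]) (by simp))
      simp only [VASS.step_ofTyped hname', vassTrans, hI, List.mem_cons, List.not_mem_nil,
        or_false, exists_eq_or_imp, exists_eq_left, unit_dec_iff, unit_zero_iff] at hy
      rcases hy with ⟨-, c', ⟨hc, rfl⟩, rfl⟩ | ⟨-, rfl⟩
      · simp only [Instr.exec, hc, if_false] at ih
        have hsum := sum_dec hc
        obtain ⟨y, hy, hr''⟩ := hR _ _ hr' _ _ (ostep (m' := c 0 + c 1 - 1) (2, -1, .run t)
          (by simp [ocaTrans]) (by simp; omega))
        simp only [VASS.step_ofTyped hname', vassTrans, List.mem_cons, List.not_mem_nil,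
          or_false, exists_eq_or_imp, exists_eq_left, unit_zero_iff] at hy
        rcases hy with ⟨h, -⟩ | ⟨-, rfl⟩ | ⟨h, -⟩
        · simp at h
        · rw [← hsum, Nat.add_sub_cancel] at hr''
          exact ih hr''
        · simp at h
      · by_cases hc : c b = 0
        · simp only [Instr.exec, hc, if_true] at ih
          obtain ⟨y, hy, hr''⟩ := hR _ _ hr' _ _ (ostep (m' := c 0 + c 1) (1, 0, .run z)
            (by simp [ocaTrans]) (by simp))
          simp only [VASS.step_ofTyped hname', vassTrans, List.mem_cons, List.not_mem_nil,
            or_false, exists_eq_or_imp, exists_eq_left, unit_zero_iff] at hy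
          rcases hy with ⟨-, rfl⟩ | ⟨h, -⟩ | ⟨h, -⟩
          · exact ih hr''
          · simp at h
          · simp at h
        -- The false claim that the counter is zero is contested.
        · obtain ⟨y, hy, hr''⟩ := hR _ _ hr' _ _ (ostep (m' := c 0 + c 1) (3, 0, .drain)
            (by simp [ocaTrans]) (by simp))
          simp only [VASS.step_ofTyped hname', vassTrans, List.mem_cons, List.not_mem_nil,
            or_false, exists_eq_or_imp, exists_eq_left, unit_zero_iff] at hy
          rcases hy with ⟨h, -⟩ | ⟨h, -⟩ | ⟨-, rfl⟩
          · simp at h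
          · simp at h
          · refine not_rel_drain hname hname' hR _ _ _ ?_ hr''
            fin_cases b <;> simp at hc ⊢ <;> omega

end not_simulates

end MachineSimulation

theorem computable_simInput (A : OCA) (B : VASS 2) (p q : ℕ) :
    Computable fun x : ℕ => (⟨A, B, (p, 2 ^ x), (q, ![2 ^ x, 0])⟩ : SimInput 2) := by
  have hvec : Primrec fun x : ℕ => (![2 ^ x, 0] : Fin 2 → ℕ) := by
    refine ((Primrec.fin_curry (f := fun x : ℕ => (![2 ^ x, 0] : Fin 2 → ℕ))).2
      ((Primrec.fin_curry₁ (f := fun i (x : ℕ) => (![2 ^ x, 0] : Fin 2 → ℕ) i)).2 fun i => ?_).swap)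
    fin_cases i
    · exact primrec_two_pow
    · exact Primrec.const 0
  have h : Primrec fun x : ℕ => (A, B, (p, 2 ^ x), (q, (![2 ^ x, 0] : Fin 2 → ℕ))) :=
    (Primrec.const A).pair ((Primrec.const B).pair
      (((Primrec.const p).pair primrec_two_pow).pair ((Primrec.const q).pair hvec)))
  exact ((Primrec.of_equiv_symm (e := SimInput.equivProd 2)).comp h).to_comp

theorem simulation_undecidable : UndecidableOn (SimInput.Valid (n := 2)) SimInput.Holds := by
  open MachineSimulation in
  obtain ⟨T, hT⟩ := exists_machine_undecidable
  have := T.fin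
  have := Fintype.ofFinite T.σ
  obtain ⟨name, hname⟩ := Countable.exists_injective_nat (Spoiler T.σ)
  obtain ⟨name', hname'⟩ := Countable.exists_injective_nat (Duplicator T.σ)
  refine undecidableOn_of_reduction hT (computable_simInput
    (OCA.ofTyped name (ocaTrans T)) (VASS.ofTyped name' (vassTrans T))
    (name (.run (.inl T.entry))) (name' (.run (.inl T.entry))))
    (fun x => ⟨OCA.wellFormed_ofTyped, VASS.wellFormed_ofTyped, fun a => Iff.rfl,
      OCA.mem_Q_ofTyped _, VASS.mem_Q_ofTyped _⟩) fun x => ⟨?_, fun h => ?_⟩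
  · rintro ⟨R, hR, hr⟩ hH
    exact not_rel_of_halts hname hname' hR hH (by simpa using hr)
  · refine ⟨_, isSimulation_rel hname hname', ?_⟩
    simpa using Rel.run (name := name) (name' := name') h

end InfiniteStateGames

theorem mainTheorem5 :
    (∀ n : ℕ, 2 ≤ n →
      InfiniteStateGames.UndecidableOn
        (InfiniteStateGames.ValidCreditInput (n := n))
        (InfiniteStateGames.FixedInitialCredit (n := n))) ∧
    InfiniteStateGames.UndecidableOn
      (InfiniteStateGames.SimInput.Valid (n := 2))
      (InfiniteStateGames.SimInput.Holds (n := 2)) :=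
  ⟨fun _ hn => InfiniteStateGames.fixedInitialCredit_undecidable hn,
    InfiniteStateGames.simulation_undecidable⟩
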